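/- Let $k$ be an algebraically closed field, $Q=\mathbb P^1_k\times\mathbb P^1_k$, and $S=k[x_0,x_1,y_0,y_1]$ its bigraded coordinate ring, with $\deg x_i=(1,0)$ and $\deg y_j=(0,1)$. Let $X\subset Q$ be a zero-dimensional closed subscheme (not necessarily reduced), $I(X)\subset S$ its saturated bihomogeneous ideal, $M_X(i,j)=\dim_k (S/I(X))_{i,j}$ its Hilbert function (zero if $i<0$ or $j<0$), and $$\Delta M_X^{(i,j)}=M_X(i,j)-M_X(i-1,j)-M_X(i,j-1)+M_X(i-1,j-1).$$ Put $a=\min\{i\in\mathbb N : I(X)_{i,0}\ne 0\}-1$ and $b=\min\{j\in\mathbb N : I(X)_{0,j}\ne 0\}-1$. For a line $L\subset Q$ of type $(1,0)$ or $(0,1)$ defined by a form $l$, the number $\#(X\cap L)$ of points of $X$ on $L$ is the degree of the scheme defined by the saturation of $(I(X),l)$, where the saturation is taken with respect to the irrelevant ideal $(x_iy_j)$ and the degree of a zero-dimensional scheme is the value of its Hilbert function in degrees $(i,j)$ with $i,j\gg0$. For a point $P'$ of $X$, let $J_{P'}\subset S$ be the component of $I(X)$ at $P'$, i.e. the ideal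 of all $f\in S$ such that $sf\in I(X)$ for some form $s$ with $s(P')\ne0$; thus $I(X)=\bigcap_{P'\in X}J_{P'}$. Let $P$ be a point of $X$ of multiplicity one, i.e. such that $\mathscr O_{X,P}$ has length $1$. Let $R$ be the $(1,0)$-line and $C$ the $(0,1)$-line through $P$, and let $p+1=\#(X\cap R)$ and $q+1=\#(X\cap C)$. Suppose that one of the following conditions holds: 1. $p=b$; 2. $q=a$; 3. $p<b$, $q<a$ and $\Delta M_X^{(i,j)}=0$ for all $(i,j)$ with $i\ge q+1$ and $j\ge p+1$. Then there exists a separator for $P\in X$ in degree $(q,p)$, i.e. a form $f\in S_{q,p}$ such that $f(P)\neq 0$ and $f\in J_{P'}$ for every point $P'\ne P$ of $X$. -/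

import Mathlib

namespace BiProj

open MvPolynomial

/-- The bigraded coordinate ring `S = k[x₀, x₁, y₀, y₁]` of `Q = ℙ¹ × ℙ¹`; `X (Sum.inl i)` is `xᵢ`
and `X (Sum.inr j)` is `yⱼ`. -/
abbrev CoordRing (k : Type*) [Field k] : Type _ := MvPolynomial (Fin 2 ⊕ Fin 2) k

/-- `xᵢ` has bidegree `(1,0)` and `yⱼ` has bidegree `(0,1)`. -/
def bidegree : Fin 2 ⊕ Fin 2 → ℕ × ℕ := Sum.elim (fun _ => (1, 0)) (fun _ => (0, 1))

/-- The bigraded piece `S_{i,j}`: the forms of bidegree `(i,j)`, that is `H⁰(𝒪_Q(i,j))`. -/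
abbrev forms (k : Type*) [Field k] (d : ℕ × ℕ) : Submodule k (CoordRing k) :=
  weightedHomogeneousSubmodule k bidegree d

noncomputable instance (k : Type*) [Field k] : GradedAlgebra (forms k) :=
  weightedGradedAlgebra k bidegree

/-- The (closed) points of `Q = ℙ¹ × ℙ¹`. -/
abbrev Point (k : Type*) [Field k] : Type _ :=
  Projectivization k (Fin 2 → k) × Projectivization k (Fin 2 → k)

/-- Value of `f` at a choice of bihomogeneous coordinates of the point `P`. Whether it vanishes does
not depend on the choice if `f` is a form. -/
noncomputable def evalAt {k : Type*} [Field k] (P : Point k) : CoordRing k →+* k :=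
  MvPolynomial.eval (Sum.elim P.1.rep P.2.rep)

/-- The irrelevant ideal `(x₀, x₁) ∩ (y₀, y₁) = (xᵢ yⱼ)` of `S`. -/
noncomputable def irrelevant (k : Type*) [Field k] : Ideal (CoordRing k) :=
  Ideal.span (Set.range fun ij : Fin 2 × Fin 2 => X (Sum.inl ij.1) * X (Sum.inr ij.2))

/-- The saturation `{f | Bⁿ f ⊆ J for some n}` of `J`, with `B` the irrelevant ideal. -/
noncomputable def saturation {k : Type*} [Field k] (J : Ideal (CoordRing k)) : Ideal (CoordRing k) where
  carrier := {f | ∃ n : ℕ, ∀ g ∈ irrelevant k ^ n, g * f ∈ J}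
  zero_mem' := ⟨0, fun g _ => by simp⟩
  add_mem' := by
    rintro f f' ⟨n, hn⟩ ⟨m, hm⟩
    refine ⟨n + m, fun g hg => ?_⟩
    rw [mul_add]
    exact J.add_mem (hn g (Ideal.pow_le_pow_right (Nat.le_add_right n m) hg))
      (hm g (Ideal.pow_le_pow_right (Nat.le_add_left m n) hg))
  smul_mem' := by
    rintro c f ⟨n, hn⟩
    refine ⟨n, fun g hg => ?_⟩
    rw [smul_eq_mul, mul_left_comm]
    exact J.mul_mem_left c (hn g hg)

/-- `dim_k (S/J)_{i,j}`, where `(S/J)_{i,j}` is the image of `S_{i,j}` in `S/J`. -/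
noncomputable def quotDim {k : Type*} [Field k] (J : Ideal (CoordRing k)) (d : ℕ × ℕ) : ℕ :=
  Module.finrank k ((forms k d).map (Ideal.Quotient.mkₐ k J).toLinearMap)

/-- The closed subscheme of `Q` with saturated ideal `J` is (empty or) zero-dimensional of degree `n`,
the degree being the stable value of the Hilbert function: `dim_k (S/J)_{i,j} = n` for
`i ≫ 0` and `j ≫ 0`. -/
def HasDegree {k : Type*} [Field k] (J : Ideal (CoordRing k)) (n : ℕ) : Prop :=
  ∃ N : ℕ, ∀ i j : ℕ, N ≤ i → N ≤ j → quotDim J (i, j) = n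

/-- The forms which do not vanish at `P`. -/
def nonvanishing {k : Type*} [Field k] (P : Point k) : Submonoid (CoordRing k) where
  carrier := {g | SetLike.IsHomogeneousElem (forms k) g ∧ evalAt P g ≠ 0}
  one_mem' := ⟨SetLike.isHomogeneousElem_one (forms k), by simp⟩
  mul_mem' := by
    rintro f g ⟨hf, hf'⟩ ⟨hg, hg'⟩
    exact ⟨hf.mul hg, by rw [map_mul]; exact mul_ne_zero hf' hg'⟩

/-- The local ring `𝒪_{Q,P}`: fractions `f / g` of forms of the same bidegree with `g(P) ≠ 0`. -/
abbrev LocalRing {k : Type*} [Field k] (P : Point k) : Type _ :=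
  HomogeneousLocalization (forms k) (nonvanishing P)

/-- The stalk at `P` of the ideal sheaf on `Q` defined by the homogeneous ideal `I`. -/
noncomputable def stalkIdeal {k : Type*} [Field k] (I : Ideal (CoordRing k)) (P : Point k) :
    Ideal (LocalRing P) :=
  Ideal.span {z | ∃ c : HomogeneousLocalization.NumDenSameDeg (forms k) (nonvanishing P),
    (c.num : CoordRing k) ∈ I ∧ HomogeneousLocalization.mk c = z}

/-- A closed subscheme `X` of `Q` with finitely many points, given by its saturated
bihomogeneous ideal `I(X)`. It is zero-dimensional as soon as it has a point. -/
structure ZeroDimScheme (k : Type*) [Field k] where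
  /-- the saturated ideal `I(X)` -/
  ideal : Ideal (CoordRing k)
  homogeneous : ideal.IsHomogeneous (forms k)
  saturated : saturation ideal = ideal
  finite_points : {P : Point k | ∀ f ∈ ideal, evalAt P f = 0}.Finite

namespace ZeroDimScheme

variable {k : Type*} [Field k] (X : ZeroDimScheme k)

/-- The set of points of `X`. -/
def points : Set (Point k) := {P | ∀ f ∈ X.ideal, evalAt P f = 0}

/-- The Hilbert function `M_X : ℤ × ℤ → ℕ`, zero in negative degrees. -/
noncomputable def hilbert (i j : ℤ) : ℕ :=
  if 0 ≤ i ∧ 0 ≤ j then quotDim X.ideal (i.toNat, j.toNat) else 0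

/-- The first difference `ΔM_X` of the Hilbert function. -/
noncomputable def hilbertDiff (i j : ℤ) : ℤ :=
  X.hilbert i j - X.hilbert (i - 1) j - X.hilbert i (j - 1) + X.hilbert (i - 1) (j - 1)

/-- `ΔM_X` is of size `(a, b)`: `a + 1` and `b + 1` are the least `i` and `j` with
`I(X)_{i,0} ≠ 0` and `I(X)_{0,j} ≠ 0`. -/
def HasSize (a b : ℕ) : Prop :=
  IsLeast {i : ℕ | ∃ f ∈ X.ideal, f ∈ forms k (i, 0) ∧ f ≠ 0} (a + 1) ∧
  IsLeast {j : ℕ | ∃ f ∈ X.ideal, f ∈ forms k (0, j) ∧ f ≠ 0} (b + 1)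

/-- The multiplicity `m_X(P)`: the length of the local ring `𝒪_{X,P}`. -/
noncomputable def mult (P : Point k) : ℕ∞ :=
  Module.length (LocalRing P ⧸ stalkIdeal X.ideal P) (LocalRing P ⧸ stalkIdeal X.ideal P)

/-- The line defined by the form `l` contains exactly `n` points of `X`: the scheme defined by the
saturation of `(I(X), l)` has degree `n`. -/
def HasPointsOnLine (l : CoordRing k) (n : ℕ) : Prop :=
  HasDegree (saturation (X.ideal ⊔ Ideal.span {l})) n

/-- The component `J_P` of `I(X)` at a point `P` of `X`: the contraction to `S` of the localization
of `I(X)` at `P`. -/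
noncomputable def component (P : Point k) : Ideal (CoordRing k) where
  carrier := {f | ∃ s ∈ nonvanishing P, s * f ∈ X.ideal}
  zero_mem' := ⟨1, one_mem _, by simp⟩
  add_mem' := by
    rintro f g ⟨s, hs, hf⟩ ⟨t, ht, hg⟩
    refine ⟨s * t, mul_mem hs ht, ?_⟩
    have h : s * t * (f + g) = t * (s * f) + s * (t * g) := by ring
    rw [h]
    exact X.ideal.add_mem (X.ideal.mul_mem_left _ hf) (X.ideal.mul_mem_left _ hg)
  smul_mem' := by
    rintro c f ⟨s, hs, hf⟩
    refine ⟨s, hs, ?_⟩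
    rw [smul_eq_mul, mul_left_comm]
    exact X.ideal.mul_mem_left c hf

/-- `f` is a separator for `P ∈ X`: `f(P) ≠ 0` and `f` lies in `J_{P'}` for all other points `P'`
of `X`. -/
def IsSeparator (P : Point k) (f : CoordRing k) : Prop :=
  evalAt P f ≠ 0 ∧ ∀ P' ∈ X.points, P' ≠ P → f ∈ X.component P'

end ZeroDimScheme

/-- The form `l` defines a line of type `d` (used for `d = (1,0)` and `d = (0,1)`) through `P`. -/
def IsLineThrough {k : Type*} [Field k] (d : ℕ × ℕ) (P : Point k) (l : CoordRing k) : Prop :=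
  l ∈ forms k d ∧ l ≠ 0 ∧ evalAt P l = 0

end BiProj

/-! Let `B` be the irrelevant ideal, `I = I(X)`, and let `Z` be the union of the components of `X`
at the points other than `P`.

Two facts about a line `C` with `q + 1` points of `X` are used throughout, both by counting
dimensions in stable degrees: a nonzero form of degree `(q, 0)` never lies in the saturation of `(I,
c)` (`HasPointsOnLine.eq_zero_of_mem_sectionIdeal`), whereas some nonzero form `H` of degree `(q +
1, 0)` does (`HasPointsOnLine.exists_mem_sectionIdeal`). Since `P` has multiplicity one, `H = r h`
with `h(P) ≠ 0` (`HasPointsOnLine.evalAt_ne_zero`).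

If `p = b`, take `G ∈ I` of degree `(0, b + 1)` and write `G = c g`; again `g(P) ≠ 0`. Then `h g` is
the separator: off `C` the form `c` is a local unit and `c h g ∈ I`; on `C` away from `P` the form
`r` is a local unit and `r h g ∈ I + (c g) = I`. The case `q = a` is the same with the factors
exchanged.

In the third case the difference `δ = M_X - M_Z` is `1` in the degrees that have a separator and `0`
in the others. There are separators in degrees `(q, j)` and `(i, p)` for large `i`, `j`
(`exists_separator_of_large`). The vanishing of `ΔM_X` produces a form of degree `(q + 1, p + 1)` in
`I`, which forces `ΔM_Z ≤ 0` from that degree on (`quotDim_add_le`). Summing `ΔM_X - ΔM_Z ≥ 0` over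
a large rectangle with lowest corner `(q, p)` gives `δ(q, p) + 1 - 1 - 1 ≥ 0`, so `δ(q, p) = 1`. -/

namespace BiProj
open MvPolynomial

/-! ### Bihomogeneous forms: dimensions and generation by linear forms. -/

section Forms
variable {k : Type*} [Field k]

/-- The forms of degree `i` in one family of variables and `j` in the other one; the first family is
`x` if `t` is true and `y` if not. -/
def biforms (k : Type*) [Field k] (t : Bool) (i j : ℕ) : Submodule k (CoordRing k) :=
  forms k (bif t then (i, j) else (j, i))

/-- The symmetry between the two factors of `Q`: lemmas are proved for linear forms in `biforms k t
0 1` and transferred to the other family by this rewriting. -/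
lemma biforms_not (t : Bool) (i j : ℕ) : biforms k (!t) i j = biforms k t j i := by
  cases t <;> rfl

lemma mul_mem_biforms {t : Bool} {i j i' j' : ℕ} {f g : CoordRing k} (hf : f ∈ biforms k t i j)
    (hg : g ∈ biforms k t i' j') : f * g ∈ biforms k t (i + i') (j + j') := by
  cases t <;> exact IsWeightedHomogeneous.mul hf hg

lemma one_mem_biforms (t : Bool) : (1 : CoordRing k) ∈ biforms k t 0 0 := by
  cases t <;> exact isWeightedHomogeneous_one k bidegree

lemma pow_mem_biforms {t : Bool} {i j : ℕ} {f : CoordRing k} (hf : f ∈ biforms k t i j) (n : ℕ) :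
    f ^ n ∈ biforms k t (n * i) (n * j) := by
  induction n with
  | zero => simpa using one_mem_biforms t
  | succ n ih => rw [pow_succ, Nat.succ_mul, Nat.succ_mul]; exact mul_mem_biforms ih hf

lemma weight_bidegree (d : Fin 2 ⊕ Fin 2 →₀ ℕ) :
    Finsupp.weight bidegree d =
      (d (Sum.inl 0) + d (Sum.inl 1), d (Sum.inr 0) + d (Sum.inr 1)) := by
  rw [Finsupp.weight_apply, Finsupp.sum_fintype _ _ (by simp)]
  ext <;> simp [bidegree, Fin.sum_univ_two]

/-- The exponents of the monomials of bidegree `(i, j)`. -/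
noncomputable def exponentsEquiv (i j : ℕ) :
    {d : Fin 2 ⊕ Fin 2 →₀ ℕ | Finsupp.weight bidegree d = (i, j)} ≃
      Finset.HasAntidiagonal.antidiagonal i × Finset.HasAntidiagonal.antidiagonal j where
  toFun d := (⟨(d.1 (Sum.inl 0), d.1 (Sum.inl 1)), by
      have := d.2; simp only [Set.mem_ofPred_eq, weight_bidegree, Prod.mk.injEq] at this
      simp [this.1]⟩, ⟨(d.1 (Sum.inr 0), d.1 (Sum.inr 1)), by
      have := d.2; simp only [Set.mem_ofPred_eq, weight_bidegree, Prod.mk.injEq] at this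
      simp [this.2]⟩)
  invFun e := ⟨Finsupp.equivFunOnFinite.symm
      (Sum.elim ![e.1.1.1, e.1.1.2] ![e.2.1.1, e.2.1.2]), by
      have h1 := e.1.2; have h2 := e.2.2
      simp only [Finset.HasAntidiagonal.mem_antidiagonal] at h1 h2
      simp [weight_bidegree, h1, h2]⟩
  left_inv d := by
    ext s
    rcases s with s | s <;> fin_cases s <;> simp
  right_inv e := by
    rcases e with ⟨⟨⟨a, b⟩, h⟩, ⟨⟨c, d⟩, h'⟩⟩
    simp

lemma finrank_forms_and_finite (i j : ℕ) :
    Module.Finite k (forms k (i, j)) ∧ Module.finrank k (forms k (i, j)) = (i + 1) * (j + 1) := by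
  have hf : Finite {d : Fin 2 ⊕ Fin 2 →₀ ℕ | Finsupp.weight bidegree d = (i, j)} :=
    Finite.of_equiv _ (exponentsEquiv i j).symm
  rw [forms, weightedHomogeneousSubmodule_eq_finsupp_supported]
  have b := basisRestrictSupport k {d : Fin 2 ⊕ Fin 2 →₀ ℕ | Finsupp.weight bidegree d = (i, j)}
  refine ⟨Module.Finite.of_basis b, ?_⟩
  refine (Module.finrank_eq_nat_card_basis b).trans ?_
  rw [Nat.card_congr (exponentsEquiv i j), Nat.card_prod, Nat.card_eq_fintype_card,
    Nat.card_eq_fintype_card, Fintype.card_coe, Fintype.card_coe, Finset.Nat.card_antidiagonal, Finset.Nat.card_antidiagonal]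

lemma finrank_forms (i j : ℕ) : Module.finrank k (forms k (i, j)) = (i + 1) * (j + 1) :=
  (finrank_forms_and_finite i j).2

instance finite_forms (d : ℕ × ℕ) : Module.Finite k (forms k d) :=
  (finrank_forms_and_finite d.1 d.2).1

instance finite_biforms (t : Bool) (i j : ℕ) : Module.Finite k (biforms k t i j) :=
  finite_forms _

lemma finrank_biforms (t : Bool) (i j : ℕ) :
    Module.finrank k (biforms k t i j) = (i + 1) * (j + 1) := by
  cases t
  · exact (finrank_forms j i).trans (mul_comm _ _)
  · exact finrank_forms i j

lemma mem_biforms_zero_zero {t : Bool} {f : CoordRing k} (hf : f ∈ biforms k t 0 0) :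
    ∃ a : k, f = C a := by
  have h1 : (⟨1, one_mem_biforms t⟩ : biforms k t 0 0) ≠ 0 := by simp [Subtype.ext_iff]
  obtain ⟨a, ha⟩ := (finrank_eq_one_iff_of_nonzero' _ h1).1 (finrank_biforms t 0 0) ⟨f, hf⟩
  exact ⟨a, by simpa [Subtype.ext_iff, MvPolynomial.smul_eq_C_mul] using ha.symm⟩

/-- Two forms spanning the degree one part of a family of variables generate all forms of positive
degree in this family. -/
lemma biforms_succ_le {t : Bool} {l l' : CoordRing k} (hl : l ∈ biforms k t 0 1)
    (hl' : l' ∈ biforms k t 0 1) (hli : LinearIndependent k ![l, l']) {i j : ℕ} {f : CoordRing k}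
    (hf : f ∈ biforms k t i (j + 1)) :
    ∃ g ∈ biforms k t i j, ∃ h ∈ biforms k t i j, f = l * g + l' * h := by
  have hspan : Submodule.span k {l, l'} = biforms k t 0 1 := by
    refine Submodule.eq_of_le_of_finrank_eq ?_ ?_
    · rw [Submodule.span_le]
      rintro _ (rfl | rfl) <;> assumption
    · have := finrank_span_eq_card hli
      rw [Matrix.range_cons_cons_empty] at this
      rw [this, finrank_biforms, Fintype.card_fin]
  have hX : ∀ y ∈ biforms k t 0 1, ∀ m ∈ biforms k t i j,
      ∃ g ∈ biforms k t i j, ∃ h ∈ biforms k t i j, y * m = l * g + l' * h := by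
    intro y hy m hm
    rw [← hspan, Submodule.mem_span_pair] at hy
    obtain ⟨a, b, rfl⟩ := hy
    refine ⟨a • m, Submodule.smul_mem _ _ hm, b • m, Submodule.smul_mem _ _ hm, ?_⟩
    simp only [smul_eq_C_mul]; ring
  let M : Submodule k (CoordRing k) :=
    (biforms k t i j).map (LinearMap.mulLeft k l) ⊔ (biforms k t i j).map (LinearMap.mulLeft k l')
  have hM : ∀ y ∈ biforms k t 0 1, ∀ m ∈ biforms k t i j, y * m ∈ M := by
    intro y hy m hm
    obtain ⟨g, hg, h, hh, e⟩ := hX y hy m hm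
    rw [e]
    exact Submodule.add_mem_sup (Submodule.mem_map.2 ⟨g, hg, rfl⟩)
      (Submodule.mem_map.2 ⟨h, hh, rfl⟩)
  suffices hfM : f ∈ M by
    obtain ⟨_, ⟨g, hg, rfl⟩, _, ⟨h, hh, rfl⟩, e⟩ := Submodule.mem_sup.1 hfM
    exact ⟨g, hg, h, hh, e.symm⟩
  have hmon : ∀ (d : Fin 2 ⊕ Fin 2 →₀ ℕ) (s : Fin 2 ⊕ Fin 2) (a : k), d s ≠ 0 →
      monomial d a = X s * monomial (d - Finsupp.single s 1) a := by
    intro d s a hs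
    rw [X, monomial_mul, one_mul, add_tsub_cancel_of_le]
    simpa [Nat.one_le_iff_ne_zero] using hs
  rw [f.as_sum]
  refine Submodule.sum_mem _ fun d hd => ?_
  have hw := hf (mem_support_iff.1 hd)
  rw [weight_bidegree] at hw
  -- A monomial of positive degree in the family contains one of its two variables, which can be
  -- split off.
  have key : ∀ s : Fin 2 ⊕ Fin 2, d s ≠ 0 → bidegree s = (bif t then (0, 1) else (1, 0)) →
      monomial d (coeff d f) ∈ M := by
    intro s hs hsX
    rw [hmon d s _ hs]
    have hsX' : (X s : CoordRing k) ∈ biforms k t 0 1 := by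
      have := isWeightedHomogeneous_X k bidegree s
      rw [hsX] at this
      exact this
    refine hM _ hsX' _ (isWeightedHomogeneous_monomial _ _ _ ?_)
    have e : Finsupp.weight bidegree (d - Finsupp.single s 1) + bidegree s =
        Finsupp.weight bidegree d := by
      have h1 : Finsupp.weight bidegree (Finsupp.single s 1) = bidegree s := by
        rw [Finsupp.weight_single, one_smul]
      rw [← h1, ← map_add, tsub_add_cancel_of_le]
      simpa [Nat.one_le_iff_ne_zero] using hs
    rw [weight_bidegree d, hw, hsX] at e
    cases t <;> simp only [cond_false, cond_true, Prod.ext_iff, Prod.fst_add, Prod.snd_add] at e ⊢ <;>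
      omega
  cases t
  · simp only [cond_false, Prod.mk.injEq] at hw
    have : d (Sum.inl 0) ≠ 0 ∨ d (Sum.inl 1) ≠ 0 := by omega
    rcases this with h | h <;> exact key _ h rfl
  · simp only [cond_true, Prod.mk.injEq] at hw
    have : d (Sum.inr 0) ≠ 0 ∨ d (Sum.inr 1) ≠ 0 := by omega
    rcases this with h | h <;> exact key _ h rfl

end Forms

/-! ### Values at points, lines, and divisibility by lines. -/

section Points
variable {k : Type*} [Field k]

lemma mul_mem_biforms' {t : Bool} {i j i' j' m n : ℕ} {f g : CoordRing k}
    (hf : f ∈ biforms k t i j) (hg : g ∈ biforms k t i' j') (hm : i + i' = m) (hn : j + j' = n) :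
    f * g ∈ biforms k t m n := by
  subst hm hn; exact mul_mem_biforms hf hg

lemma pow_mem_biforms_left {t : Bool} {f : CoordRing k} (hf : f ∈ biforms k t 1 0) (n : ℕ) :
    f ^ n ∈ biforms k t n 0 := by
  simpa using pow_mem_biforms hf n

lemma pow_mem_biforms_right {t : Bool} {f : CoordRing k} (hf : f ∈ biforms k t 0 1) (n : ℕ) :
    f ^ n ∈ biforms k t 0 n := by
  simpa using pow_mem_biforms hf n

lemma evalAt_smul (P : Point k) (a : k) (f : CoordRing k) :
    evalAt P (a • f) = a * evalAt P f := by
  simp [evalAt]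

/-- Evaluation at a point as a linear form. -/
noncomputable def evalLinear (P : Point k) : CoordRing k →ₗ[k] k where
  toFun := evalAt P
  map_add' := map_add _
  map_smul' a f := evalAt_smul P a f

lemma linearIndependent_of_evalAt {P : Point k} {l l' : CoordRing k} (hl : l ≠ 0)
    (hlP : evalAt P l = 0) (hlP' : evalAt P l' ≠ 0) : LinearIndependent k ![l, l'] := by
  rw [LinearIndependent.pair_iff]
  intro a b h
  have h1 := congrArg (evalAt P) h
  rw [map_add, evalAt_smul, evalAt_smul, hlP, mul_zero, zero_add, map_zero] at h1
  have hb : b = 0 := (mul_eq_zero.1 h1).resolve_right hlP'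
  rw [hb, zero_smul, add_zero] at h
  exact ⟨(smul_eq_zero.1 h).resolve_right hl, hb⟩

lemma exists_linear_evalAt_ne_zero (t : Bool) (P : Point k) :
    ∃ l ∈ biforms k t 0 1, evalAt P l ≠ 0 := by
  cases t
  · obtain ⟨i, hi⟩ := Function.ne_iff.1 P.1.rep_nonzero
    exact ⟨X (Sum.inl i), isWeightedHomogeneous_X k bidegree _, by simpa [evalAt] using hi⟩
  · obtain ⟨i, hi⟩ := Function.ne_iff.1 P.2.rep_nonzero
    exact ⟨X (Sum.inr i), isWeightedHomogeneous_X k bidegree _, by simpa [evalAt] using hi⟩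

lemma exists_evalAt_ne_zero (t : Bool) (P : Point k) (i j : ℕ) :
    ∃ l ∈ biforms k t i j, evalAt P l ≠ 0 := by
  obtain ⟨l, hl, hlP⟩ := exists_linear_evalAt_ne_zero t P
  obtain ⟨l', hl', hlP'⟩ := exists_linear_evalAt_ne_zero (!t) P
  rw [biforms_not] at hl'
  exact ⟨l' ^ i * l ^ j, mul_mem_biforms' (pow_mem_biforms_left hl' i) (pow_mem_biforms_right hl j)
    (by simp) (by simp), by simp [hlP, hlP']⟩

/-- The coordinate vector of a point in one family of variables. -/
noncomputable def coordVec (t : Bool) (P : Point k) : Fin 2 → k := bif t then P.2.rep else P.1.rep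

/-- The line of a given family through a given vector. -/
noncomputable def lineForm (t : Bool) (v : Fin 2 → k) : CoordRing k :=
  bif t then C (v 1) * X (Sum.inr 0) - C (v 0) * X (Sum.inr 1)
  else C (v 1) * X (Sum.inl 0) - C (v 0) * X (Sum.inl 1)

lemma lineForm_mem (t : Bool) (v : Fin 2 → k) : lineForm t v ∈ biforms k t 0 1 := by
  cases t <;> exact Submodule.sub_mem _ ((isWeightedHomogeneous_X k bidegree _).C_mul _)
    ((isWeightedHomogeneous_X k bidegree _).C_mul _)

lemma evalAt_lineForm (t : Bool) (v : Fin 2 → k) (P : Point k) :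
    evalAt P (lineForm t v) = v 1 * coordVec t P 0 - v 0 * coordVec t P 1 := by
  cases t <;> simp [lineForm, evalAt, coordVec]

lemma lineForm_ne_zero (t : Bool) {v : Fin 2 → k} (hv : v ≠ 0) : lineForm t v ≠ 0 := by
  intro h
  apply hv
  have key : ∀ w : Fin 2 → k, v 1 * w 0 - v 0 * w 1 = 0 := by
    intro w
    have := congrArg (MvPolynomial.eval (Sum.elim w w)) h
    cases t <;> simpa [lineForm] using this
  ext i
  fin_cases i
  · simpa using key ![0, 1]
  · simpa using key ![1, 0]

lemma coordVec_ne_zero (t : Bool) (P : Point k) : coordVec t P ≠ 0 := by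
  cases t
  exacts [P.1.rep_nonzero, P.2.rep_nonzero]

lemma exists_line_through (t : Bool) (P : Point k) :
    ∃ l ∈ biforms k t 0 1, l ≠ 0 ∧ evalAt P l = 0 :=
  ⟨_, lineForm_mem t (coordVec t P), lineForm_ne_zero t (coordVec_ne_zero t P), by
    rw [evalAt_lineForm]; ring⟩

lemma mk_eq_of_cross_eq_zero {p p' : Projectivization k (Fin 2 → k)}
    (h : p.rep 1 * p'.rep 0 - p.rep 0 * p'.rep 1 = 0) : p = p' := by
  rw [← p.mk_rep, ← p'.mk_rep, Projectivization.mk_eq_mk_iff']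
  have hp := p.rep_nonzero
  have hp' := p'.rep_nonzero
  by_cases h0 : p'.rep 0 = 0
  · have h1 : p'.rep 1 ≠ 0 := fun h1 => hp' (by ext i; fin_cases i <;> assumption)
    have h2 : p.rep 0 = 0 := by
      rw [h0, mul_zero, zero_sub, neg_eq_zero] at h
      exact (mul_eq_zero.1 h).resolve_right h1
    refine ⟨p.rep 1 / p'.rep 1, ?_⟩
    ext i; fin_cases i
    · simp [h0, h2]
    · simp [h1]
  · refine ⟨p.rep 0 / p'.rep 0, ?_⟩
    ext i; fin_cases i
    · simp [h0]
    · simp only [Pi.smul_apply, smul_eq_mul, Fin.mk_one, Fin.isValue]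
      field_simp
      linear_combination -h

/-- A line vanishing at two points shows that they agree in the corresponding coordinate. -/
lemma cross_eq_zero_of_line {t : Bool} {P P' : Point k} {l : CoordRing k}
    (hl : l ∈ biforms k t 0 1) (hl0 : l ≠ 0) (hP : evalAt P l = 0) (hP' : evalAt P' l = 0) :
    coordVec t P 1 * coordVec t P' 0 - coordVec t P 0 * coordVec t P' 1 = 0 := by
  -- Otherwise `l` and the line through `P` are independent, hence generate all linear forms of the
  -- family; but both vanish at `P`.
  by_contra hne
  rw [← evalAt_lineForm] at hne
  obtain ⟨f, hf, hfP⟩ := exists_linear_evalAt_ne_zero t P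
  obtain ⟨g, -, h, -, rfl⟩ := biforms_succ_le hl (lineForm_mem t (coordVec t P))
    (linearIndependent_of_evalAt hl0 hP' hne) hf
  apply hfP
  rw [map_add, map_mul, map_mul, hP, evalAt_lineForm]
  ring

lemma eq_of_lines {t : Bool} {P P' : Point k} {r c : CoordRing k}
    (hr : r ∈ biforms k t 1 0) (hr0 : r ≠ 0) (hrP : evalAt P r = 0) (hrP' : evalAt P' r = 0)
    (hc : c ∈ biforms k t 0 1) (hc0 : c ≠ 0) (hcP : evalAt P c = 0) (hcP' : evalAt P' c = 0) :
    P = P' := by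
  have h1 := cross_eq_zero_of_line hc hc0 hcP hcP'
  rw [← biforms_not] at hr
  have h2 := cross_eq_zero_of_line hr hr0 hrP hrP'
  cases t
  · exact Prod.ext (mk_eq_of_cross_eq_zero h1) (mk_eq_of_cross_eq_zero h2)
  · exact Prod.ext (mk_eq_of_cross_eq_zero h2) (mk_eq_of_cross_eq_zero h1)

/-- Restriction to the line `l = 0`: modulo `l` only the pure power of `l'` survives, with a
coefficient `h` in the other family of variables. -/
lemma biforms_succ_le_pow {t : Bool} {l l' : CoordRing k} (hl : l ∈ biforms k t 0 1)
    (hl' : l' ∈ biforms k t 0 1) (hli : LinearIndependent k ![l, l']) {i : ℕ} (j : ℕ)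
    {f : CoordRing k} (hf : f ∈ biforms k t i (j + 1)) :
    ∃ g ∈ biforms k t i j, ∃ h ∈ biforms k t i 0, f = l * g + l' ^ (j + 1) * h := by
  induction j generalizing f with
  | zero =>
    obtain ⟨g, hg, h, hh, e⟩ := biforms_succ_le hl hl' hli hf
    exact ⟨g, hg, h, hh, by simpa using e⟩
  | succ j ih =>
    obtain ⟨g, hg, h, hh, e⟩ := biforms_succ_le hl hl' hli hf
    obtain ⟨g', hg', h', hh', e'⟩ := ih hh
    refine ⟨g + l' * g', Submodule.add_mem _ hg (mul_mem_biforms' hl' hg' (by omega) (by omega)),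
      h', hh', ?_⟩
    rw [e, e']; ring

/-- A form in one family of variables which vanishes at a point is divisible by the line. -/
lemma exists_eq_line_mul {t : Bool} {P : Point k} {l : CoordRing k} (hl : l ∈ biforms k t 0 1)
    (hl0 : l ≠ 0) (hlP : evalAt P l = 0) {j : ℕ} {f : CoordRing k}
    (hf : f ∈ biforms k t 0 (j + 1)) (hfP : evalAt P f = 0) :
    ∃ g ∈ biforms k t 0 j, f = l * g := by
  obtain ⟨l', hl', hlP'⟩ := exists_linear_evalAt_ne_zero t P
  obtain ⟨g, hg, h, hh, rfl⟩ := biforms_succ_le_pow hl hl' (linearIndependent_of_evalAt hl0 hlP hlP')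
    j hf
  obtain ⟨a, rfl⟩ := mem_biforms_zero_zero hh
  rw [map_add, map_mul, hlP, zero_mul, zero_add, map_mul, map_pow] at hfP
  have : evalAt P (C a) = a := by simp [evalAt]
  rw [this] at hfP
  have ha : a = 0 := (mul_eq_zero.1 hfP).resolve_left (pow_ne_zero _ hlP')
  exact ⟨g, hg, by simp [ha]⟩

lemma evalAt_ne_zero_of_mem_zero {t : Bool} (P : Point k) {f : CoordRing k}
    (hf : f ∈ biforms k t 0 0) (hf0 : f ≠ 0) : evalAt P f ≠ 0 := by
  obtain ⟨a, rfl⟩ := mem_biforms_zero_zero hf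
  simpa [evalAt] using hf0

lemma line_dvd {t : Bool} {P : Point k} {l : CoordRing k} (hl : l ∈ biforms k t 0 1)
    (hl0 : l ≠ 0) (hlP : evalAt P l = 0) {j : ℕ} {f : CoordRing k}
    (hf : f ∈ biforms k t 0 j) (hfP : evalAt P f = 0) : l ∣ f := by
  cases j with
  | zero =>
    by_cases hf0 : f = 0
    · simp [hf0]
    · exact absurd hfP (evalAt_ne_zero_of_mem_zero P hf hf0)
  | succ j =>
    obtain ⟨g, -, e⟩ := exists_eq_line_mul hl hl0 hlP hf hfP
    exact ⟨g, e⟩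

lemma exists_eq_line_pow_mul {t : Bool} {P : Point k} {l : CoordRing k} (hl : l ∈ biforms k t 0 1)
    (hl0 : l ≠ 0) (hlP : evalAt P l = 0) (j : ℕ) {f : CoordRing k}
    (hf : f ∈ biforms k t 0 j) (hf0 : f ≠ 0) :
    ∃ m n : ℕ, ∃ g ∈ biforms k t 0 n, evalAt P g ≠ 0 ∧ f = l ^ m * g := by
  induction j generalizing f with
  | zero => exact ⟨0, 0, f, hf, evalAt_ne_zero_of_mem_zero P hf hf0, by simp⟩
  | succ j ih =>
    by_cases hfP : evalAt P f = 0
    · obtain ⟨g, hg, rfl⟩ := exists_eq_line_mul hl hl0 hlP hf hfP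
      obtain ⟨m, n, g', hg', hP', rfl⟩ := ih hg (right_ne_zero_of_mul hf0)
      exact ⟨m + 1, n, g', hg', hP', by ring⟩
    · exact ⟨0, _, f, hf, hfP, by simp⟩

lemma eval_smul_of_mem_forms {i j : ℕ} {f : CoordRing k} (hf : f ∈ forms k (i, j))
    (x y : Fin 2 → k) (s t : k) :
    MvPolynomial.eval (Sum.elim (s • x) (t • y)) f =
      s ^ i * t ^ j * MvPolynomial.eval (Sum.elim x y) f := by
  rw [eval_eq', eval_eq', Finset.mul_sum]
  refine Finset.sum_congr rfl fun d hd => ?_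
  have hw := hf (mem_support_iff.1 hd)
  rw [weight_bidegree, Prod.mk.injEq] at hw
  rw [← hw.1, ← hw.2]
  simp only [Fintype.prod_sum_type, Fin.prod_univ_two, Sum.elim_inl, Sum.elim_inr, Pi.smul_apply,
    smul_eq_mul]
  ring

/-- The point with given coordinate vectors. -/
noncomputable def pointMk {x y : Fin 2 → k} (hx : x ≠ 0) (hy : y ≠ 0) : Point k :=
  (Projectivization.mk k x hx, Projectivization.mk k y hy)

/-- The chosen representatives differ from `x` and `y` by units, so only nonvanishing can be
compared. -/
lemma evalAt_pointMk {x y : Fin 2 → k} (hx : x ≠ 0) (hy : y ≠ 0) {d : ℕ × ℕ} {f : CoordRing k}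
    (hf : f ∈ forms k d) :
    evalAt (pointMk hx hy) f ≠ 0 ↔ MvPolynomial.eval (Sum.elim x y) f ≠ 0 := by
  obtain ⟨i, j⟩ := d
  obtain ⟨a, ha⟩ := Projectivization.exists_smul_eq_mk_rep k x hx
  obtain ⟨b, hb⟩ := Projectivization.exists_smul_eq_mk_rep k y hy
  have : evalAt (pointMk hx hy) f = (a : k) ^ i * (b : k) ^ j * MvPolynomial.eval (Sum.elim x y) f := by
    rw [← eval_smul_of_mem_forms hf, evalAt, pointMk]
    simp only [← ha, ← hb]
    rfl
  rw [this]
  simp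

lemma exists_point_evalAt_ne_zero [Infinite k] {d : ℕ × ℕ} {f : CoordRing k} (hf : f ∈ forms k d)
    (hf0 : f ≠ 0) : ∃ P : Point k, evalAt P f ≠ 0 := by
  -- The extra variables force both coordinate vectors to be nonzero.
  have h : f * X (Sum.inl 0) * X (Sum.inr 0) ≠ 0 := by simp [hf0]
  obtain ⟨v, hv⟩ : ∃ v, MvPolynomial.eval v (f * X (Sum.inl 0) * X (Sum.inr 0)) ≠ 0 := by
    by_contra hcon
    push Not at hcon
    exact h (MvPolynomial.funext fun v => by simpa using hcon v)
  simp only [map_mul, eval_X, ne_eq, mul_eq_zero, not_or] at hv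
  have hx : (v ∘ Sum.inl) ≠ 0 := fun e => hv.1.2 (congrFun e 0)
  have hy : (v ∘ Sum.inr) ≠ 0 := fun e => hv.2 (congrFun e 0)
  refine ⟨pointMk hx hy, (evalAt_pointMk hx hy hf).2 ?_⟩
  rw [Sum.elim_comp_inl_inr]
  exact hv.1.1

end Points

/-! ### Saturation as a local condition. -/

section Saturation
variable {k : Type*} [Field k]

lemma mem_nonvanishing_of_mem_biforms {t : Bool} {i j : ℕ} {P : Point k} {f : CoordRing k}
    (hf : f ∈ biforms k t i j) (hP : evalAt P f ≠ 0) : f ∈ nonvanishing P :=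
  ⟨⟨_, hf⟩, hP⟩

lemma mul_coord_mem_irrelevant (i j : Fin 2) :
    (X (Sum.inl i) * X (Sum.inr j) : CoordRing k) ∈ irrelevant k :=
  Ideal.subset_span ⟨(i, j), rfl⟩

lemma exists_mem_nonvanishing_of_mem_saturation {J : Ideal (CoordRing k)} {f : CoordRing k}
    (hf : f ∈ saturation J) (P : Point k) : ∃ s ∈ nonvanishing P, s * f ∈ J := by
  obtain ⟨n, hn⟩ := hf
  obtain ⟨i, hi⟩ := Function.ne_iff.1 P.1.rep_nonzero
  obtain ⟨j, hj⟩ := Function.ne_iff.1 P.2.rep_nonzero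
  refine ⟨_, ?_, hn _ (Ideal.pow_mem_pow (mul_coord_mem_irrelevant i j) n)⟩
  have h1 : (X (Sum.inl i) : CoordRing k) ∈ nonvanishing P :=
    ⟨⟨_, isWeightedHomogeneous_X k bidegree _⟩, by simpa [evalAt] using hi⟩
  have h2 : (X (Sum.inr j) : CoordRing k) ∈ nonvanishing P :=
    ⟨⟨_, isWeightedHomogeneous_X k bidegree _⟩, by simpa [evalAt] using hj⟩
  exact pow_mem (mul_mem h1 h2) n

/-- Membership in the saturation can be checked locally, by the Nullstellensatz. -/
lemma mem_saturation_of_local [IsAlgClosed k] {J : Ideal (CoordRing k)} {f : CoordRing k}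
    (h : ∀ P : Point k, ∃ s ∈ nonvanishing P, s * f ∈ J) : f ∈ saturation J := by
  let D : Ideal (CoordRing k) :=
    { carrier := {s | s * f ∈ J}
      zero_mem' := by simp
      add_mem' := fun {a b} ha hb => by
        simp only [Set.mem_ofPred_eq] at ha hb ⊢
        rw [add_mul]; exact J.add_mem ha hb
      smul_mem' := fun c a ha => by
        simp only [Set.mem_ofPred_eq] at ha ⊢
        rw [smul_eq_mul, mul_assoc]; exact J.mul_mem_left c ha }
  -- A common zero of the conductor `D` has `x = 0` or `y = 0`, since elsewhere it would define a
  -- point of `Q`, at which some element of `D` is nonzero.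
  have hB : irrelevant k ≤ D.radical := by
    rw [← vanishingIdeal_zeroLocus_eq_radical (K := k) D, irrelevant, Ideal.span_le]
    rintro _ ⟨⟨i, j⟩, rfl⟩
    rw [SetLike.mem_coe, mem_vanishingIdeal_iff]
    intro v hv
    by_contra hne
    simp only [map_mul, aeval_X, mul_eq_zero, not_or] at hne
    have hx : (v ∘ Sum.inl) ≠ 0 := fun e => hne.1 (congrFun e i)
    have hy : (v ∘ Sum.inr) ≠ 0 := fun e => hne.2 (congrFun e j)
    obtain ⟨s, ⟨⟨d, hd⟩, hsP⟩, hs⟩ := h (pointMk hx hy)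
    rw [evalAt_pointMk hx hy hd, Sum.elim_comp_inl_inr] at hsP
    exact hsP (by simpa [aeval_eq_eval] using hv s hs)
  have hfg : (irrelevant k).FG := IsNoetherian.noetherian _
  obtain ⟨n, hn⟩ := Ideal.exists_pow_le_of_le_radical_of_fg hB hfg
  exact ⟨n, fun g hg => hn hg⟩

end Saturation

/-! ### Local components of the ideal and points of multiplicity one. -/

namespace ZeroDimScheme
section
variable {k : Type*} [Field k] (X : ZeroDimScheme k)

lemma exists_mem_ideal_of_notMem_points {P : Point k} (hP : P ∉ X.points) :
    ∃ s ∈ nonvanishing P, s ∈ X.ideal := by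
  simp only [points, Set.mem_ofPred_eq, not_forall] at hP
  obtain ⟨f, hf, hfP⟩ := hP
  by_contra hcon
  push Not at hcon
  apply hfP
  classical
  rw [← DirectSum.sum_support_decompose (forms k) f, map_sum]
  refine Finset.sum_eq_zero fun d _ => ?_
  by_contra hne
  exact hcon _ ⟨⟨d, SetLike.coe_mem _⟩, hne⟩ (X.homogeneous d hf)

/-- The nontrivial inclusion in `I(X) = ⋂ J_P`: away from `X` the ideal contains a local unit, so
the condition is local at the points of `X` only. -/
lemma mem_ideal_of_forall_component [IsAlgClosed k] {f : CoordRing k}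
    (h : ∀ P ∈ X.points, f ∈ X.component P) : f ∈ X.ideal := by
  rw [← X.saturated]
  refine mem_saturation_of_local fun P => ?_
  by_cases hP : P ∈ X.points
  · exact h P hP
  · obtain ⟨s, hs, hsI⟩ := X.exists_mem_ideal_of_notMem_points hP
    exact ⟨s, hs, X.ideal.mul_mem_right _ hsI⟩

lemma ideal_le_component (P : Point k) : X.ideal ≤ X.component P :=
  fun f hf => ⟨1, one_mem _, by simpa using hf⟩

lemma mem_component_of_mul_mem {P : Point k} {s f : CoordRing k} (hs : s ∈ nonvanishing P)
    (h : s * f ∈ X.component P) : f ∈ X.component P := by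
  obtain ⟨s', hs', h'⟩ := h
  exact ⟨s' * s, mul_mem hs' hs, by rwa [mul_assoc]⟩

/-- Elements of the stalk ideal are represented by fractions with numerator in the ideal. -/
lemma exists_of_mem_stalkIdeal {P : Point k} {z : LocalRing P} (hz : z ∈ stalkIdeal X.ideal P) :
    ∃ c : HomogeneousLocalization.NumDenSameDeg (forms k) (nonvanishing P),
      (c.num : CoordRing k) ∈ X.ideal ∧ HomogeneousLocalization.mk c = z := by
  refine Submodule.span_induction (fun _ h => h) ?_ ?_ ?_ hz
  · exact ⟨0, by simp, by simp⟩
  · rintro _ _ - - ⟨c, hc, rfl⟩ ⟨d, hd, rfl⟩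
    refine ⟨c + d, ?_, by simp⟩
    rw [HomogeneousLocalization.NumDenSameDeg.num_add]
    exact X.ideal.add_mem (X.ideal.mul_mem_left _ hd) (X.ideal.mul_mem_left _ hc)
  · rintro a _ - ⟨c, hc, rfl⟩
    obtain ⟨a, rfl⟩ := HomogeneousLocalization.mk_surjective a
    refine ⟨a * c, ?_, by simp⟩
    rw [HomogeneousLocalization.NumDenSameDeg.num_mul]
    exact X.ideal.mul_mem_left _ hc

/-- The value at `P` of a germ. -/
noncomputable def evalLocal (P : Point k) : LocalRing P →+* k :=
  (IsLocalization.lift (M := nonvanishing P) (S := Localization (nonvanishing P)) (g := evalAt P)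
    fun y => isUnit_iff_ne_zero.2 y.2.2).comp
    (algebraMap (LocalRing P) (Localization (nonvanishing P)))

lemma evalLocal_mk (P : Point k)
    (c : HomogeneousLocalization.NumDenSameDeg (forms k) (nonvanishing P)) :
    evalAt P c.den * evalLocal P (HomogeneousLocalization.mk c) = evalAt P c.num := by
  rw [evalLocal, RingHom.comp_apply, HomogeneousLocalization.algebraMap_apply,
    HomogeneousLocalization.val_mk, Localization.mk_eq_mk']
  exact ((IsLocalization.lift_mk'_spec (M := nonvanishing P) (S := Localization (nonvanishing P))
    (g := evalAt P) _ _ _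
    ⟨c.den, c.den_mem⟩).1 rfl).symm

/-- At a point of multiplicity one, the component is the ideal of the point. -/
lemma mem_component_of_evalAt_eq_zero {P : Point k} (hP : P ∈ X.points) (hmult : X.mult P = 1)
    {d : ℕ × ℕ} {f : CoordRing k} (hf : f ∈ forms k d) (hfP : evalAt P f = 0) :
    f ∈ X.component P := by
  have hunit := (isSimpleModule_self_iff_isUnit.1 (Module.length_eq_one_iff.1 hmult)).2
  have hzero : ∀ z ∈ stalkIdeal X.ideal P, evalLocal P z = 0 := by
    intro z hz
    obtain ⟨c, hc, rfl⟩ := X.exists_of_mem_stalkIdeal hz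
    have := evalLocal_mk P c
    rw [hP _ hc] at this
    exact (mul_eq_zero.1 this).resolve_left c.den_mem.2
  obtain ⟨g, hg, hgP⟩ := exists_evalAt_ne_zero true P d.1 d.2
  let c : HomogeneousLocalization.NumDenSameDeg (forms k) (nonvanishing P) :=
    ⟨d, ⟨f, hf⟩, ⟨g, hg⟩, ⟨⟨d, hg⟩, hgP⟩⟩
  have hc0 : evalLocal P (HomogeneousLocalization.mk c) = 0 := by
    have := evalLocal_mk P c
    rw [hfP] at this
    exact (mul_eq_zero.1 this).resolve_left hgP
  have hmem : HomogeneousLocalization.mk c ∈ stalkIdeal X.ideal P := by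
    -- The local ring of `X` at `P` is a field. If the germ of `f` were nonzero there, it would have
    -- an inverse, contradicting that evaluation at `P` kills both this germ and the stalk ideal.
    by_contra hne
    obtain ⟨w, hw⟩ := (hunit _ (mt Ideal.Quotient.eq_zero_iff_mem.1 hne)).exists_right_inv
    obtain ⟨w, rfl⟩ := Ideal.Quotient.mk_surjective w
    rw [← map_mul, ← map_one (Ideal.Quotient.mk (stalkIdeal X.ideal P)), Ideal.Quotient.eq] at hw
    have := hzero _ hw
    rw [map_sub, map_mul, hc0, map_one] at this
    simp at this
  obtain ⟨e, he, hce⟩ := X.exists_of_mem_stalkIdeal hmem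
  have hv := congrArg HomogeneousLocalization.val hce
  rw [HomogeneousLocalization.val_mk, HomogeneousLocalization.val_mk, Localization.mk_eq_mk_iff,
    Localization.r_iff_exists] at hv
  obtain ⟨s, hs⟩ := hv
  refine ⟨s * e.den, mul_mem s.2 e.den_mem, ?_⟩
  have hs' : (s : CoordRing k) * (g * e.num) = s * (e.den * f) := hs
  rw [mul_assoc, ← hs']
  exact X.ideal.mul_mem_left _ (X.ideal.mul_mem_left _ he)

end
end ZeroDimScheme
-- Points of `X` on a line, and the separator when `p = b` or `q = a`.
namespace ZeroDimScheme
section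
variable {k : Type*} [Field k] (X : ZeroDimScheme k)

/-- The ideal of the intersection of `X` with the curve defined by `l`. -/
noncomputable abbrev sectionIdeal (l : CoordRing k) : Ideal (CoordRing k) :=
  saturation (X.ideal ⊔ Ideal.span {l})

lemma le_saturation (J : Ideal (CoordRing k)) : J ≤ saturation J :=
  fun _ hf => ⟨0, fun g _ => J.mul_mem_left g hf⟩

lemma ideal_le_sectionIdeal (l : CoordRing k) : X.ideal ≤ X.sectionIdeal l :=
  le_sup_left.trans (le_saturation _)

lemma self_mem_sectionIdeal (l : CoordRing k) : l ∈ X.sectionIdeal l :=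
  le_saturation _ (Ideal.mem_sup_right (Ideal.mem_span_singleton_self l))

/-- A form that vanishes at no point of `X` is a local unit along `X`, hence regular modulo the
section ideal. -/
lemma mem_sectionIdeal_of_mul_mem [IsAlgClosed k] {l u f : CoordRing k}
    (hu : ∀ P ∈ X.points, u ∈ nonvanishing P) (h : u * f ∈ X.sectionIdeal l) :
    f ∈ X.sectionIdeal l := by
  refine mem_saturation_of_local fun P => ?_
  by_cases hP : P ∈ X.points
  · obtain ⟨s, hs, hsf⟩ := exists_mem_nonvanishing_of_mem_saturation h P
    exact ⟨s * u, mul_mem hs (hu P hP), by rwa [mul_assoc]⟩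
  · obtain ⟨s, hs, hsI⟩ := X.exists_mem_ideal_of_notMem_points hP
    exact ⟨s, hs, Ideal.mul_mem_right _ _ (Ideal.mem_sup_left hsI)⟩

lemma evalAt_eq_zero_of_mem_sectionIdeal {P : Point k} (hP : P ∈ X.points) {l f : CoordRing k}
    (hl : evalAt P l = 0) (hf : f ∈ X.sectionIdeal l) : evalAt P f = 0 := by
  obtain ⟨s, hs, h⟩ := exists_mem_nonvanishing_of_mem_saturation hf P
  obtain ⟨g, hg, e, he, hge⟩ := Submodule.mem_sup.1 h
  obtain ⟨e, rfl⟩ := Ideal.mem_span_singleton.1 he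
  have := congrArg (evalAt P) hge
  rw [map_add, map_mul, map_mul, hl, hP g hg, zero_mul, zero_add] at this
  exact (mul_eq_zero.1 this.symm).resolve_left hs.2

/-- The image of the forms of a given degree in a quotient of the coordinate ring. -/
noncomputable def quotPiece (J : Ideal (CoordRing k)) (t : Bool) (i j : ℕ) :
    Submodule k (CoordRing k ⧸ J) :=
  (biforms k t i j).map (Ideal.Quotient.mkₐ k J).toLinearMap

instance (J : Ideal (CoordRing k)) (t : Bool) (i j : ℕ) : Module.Finite k (quotPiece J t i j) :=
  Module.Finite.map _ _

lemma HasPointsOnLine.exists_finrank_quotPiece {l : CoordRing k} {n : ℕ}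
    (h : X.HasPointsOnLine l n) (t : Bool) : ∃ N : ℕ, ∀ i j : ℕ, N ≤ i → N ≤ j →
      Module.finrank k (quotPiece (X.sectionIdeal l) t i j) = n := by
  obtain ⟨N, hN⟩ := h
  refine ⟨N, fun i j hi hj => ?_⟩
  cases t
  exacts [hN j i hj hi, hN i j hi hj]

/-- No form of degree `q` cuts out `q + 1` points on a line. -/
lemma HasPointsOnLine.eq_zero_of_mem_sectionIdeal {l : CoordRing k} {q : ℕ}
    (h : X.HasPointsOnLine l (q + 1)) {t : Bool} {P : Point k} (hl : l ∈ biforms k t 0 1)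
    (hl0 : l ≠ 0) (hlP : evalAt P l = 0) {w : CoordRing k} (hw : w ∈ biforms k t q 0)
    (hwK : w ∈ X.sectionIdeal l) : w = 0 := by
  by_contra hw0
  obtain ⟨N, hN⟩ := HasPointsOnLine.exists_finrank_quotPiece X h t
  obtain ⟨l', hl', hlP'⟩ := exists_linear_evalAt_ne_zero t P
  have hli := linearIndependent_of_evalAt hl0 hlP hlP'
  set K := X.sectionIdeal l
  let φ : biforms k t (q + N) 0 →ₗ[k] CoordRing k ⧸ K :=
    ((Ideal.Quotient.mkₐ k K).toLinearMap ∘ₗ LinearMap.mulLeft k (l' ^ (N + 1))).domRestrict _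
  have hφ : ∀ g, φ g = Ideal.Quotient.mk K (l' ^ (N + 1) * g) := fun g => rfl
  -- This stable piece has dimension `q + 1`. Modulo `l` it is the image of a space of dimension `q
  -- + N + 1`, and the multiples of `w` give a kernel of dimension at least `N + 1`, leaving at most
  -- `q`.
  have h1 : quotPiece K t (q + N) (N + 1) ≤ LinearMap.range φ := by
    rintro _ ⟨f, hf, rfl⟩
    obtain ⟨g, -, m, hm, rfl⟩ := biforms_succ_le_pow hl hl' hli N hf
    refine ⟨⟨m, hm⟩, ?_⟩
    rw [hφ]
    refine (Ideal.Quotient.eq.2 ?_)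
    have : l' ^ (N + 1) * m - (l * g + l' ^ (N + 1) * m) = -g * l := by ring
    rw [this]
    exact K.mul_mem_left _ (X.self_mem_sectionIdeal l)
  have h2 : Module.finrank k (biforms k t N 0) ≤ Module.finrank k (LinearMap.ker φ) := by
    have hmem : ∀ g : biforms k t N 0, w * g ∈ biforms k t (q + N) 0 := fun g =>
      mul_mem_biforms hw g.2
    let ψ : biforms k t N 0 →ₗ[k] LinearMap.ker φ :=
      { toFun := fun g => ⟨⟨w * g, hmem g⟩, by
          rw [LinearMap.mem_ker, hφ]
          exact Ideal.Quotient.eq_zero_iff_mem.2 (K.mul_mem_left _ (K.mul_mem_right _ hwK))⟩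
        map_add' := fun a b => by ext1; ext1; simp [mul_add]
        map_smul' := fun a b => by ext1; ext1; simp }
    refine LinearMap.finrank_le_finrank_of_injective (f := ψ) fun a b hab => ?_
    have : w * (a : CoordRing k) = w * b := congrArg (fun z => ((z : biforms k t (q + N) 0) :
      CoordRing k)) (congrArg Subtype.val hab)
    exact Subtype.ext (mul_left_cancel₀ hw0 this)
  have h3 := LinearMap.finrank_range_add_finrank_ker φ
  have h4 := Submodule.finrank_mono h1
  rw [hN _ _ (by omega) (by omega)] at h4
  rw [finrank_biforms] at h2 h3
  omega

/-- The points of `X` on a line are cut out by a form of degree equal to their number. -/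
lemma HasPointsOnLine.exists_mem_sectionIdeal [IsAlgClosed k] {l : CoordRing k} {n : ℕ}
    (h : X.HasPointsOnLine l n) {t : Bool} {u v : CoordRing k} (hu : u ∈ biforms k t 1 0)
    (hv : v ∈ biforms k t 0 1) (huX : ∀ P ∈ X.points, evalAt P u ≠ 0)
    (hvX : ∀ P ∈ X.points, evalAt P v ≠ 0) :
    ∃ H ∈ biforms k t n 0, H ∈ X.sectionIdeal l ∧ H ≠ 0 := by
  obtain ⟨N, hN⟩ := HasPointsOnLine.exists_finrank_quotPiece X h t
  set K := X.sectionIdeal l with hK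
  have hm : u ^ N * v ^ N ∈ biforms k t N N :=
    mul_mem_biforms' (pow_mem_biforms_left hu N) (pow_mem_biforms_right hv N) (by simp) (by simp)
  -- The factor `u ^ N * v ^ N` moves a space of dimension `n + 1` into a stable degree, where the
  -- quotient has dimension `n`; being regular along `X`, the factor can be cancelled afterwards.
  let φ : biforms k t n 0 →ₗ[k] quotPiece K t (n + N) N :=
    { toFun := fun g => ⟨Ideal.Quotient.mk K (g * (u ^ N * v ^ N)),
        ⟨_, mul_mem_biforms' g.2 hm rfl (by simp), rfl⟩⟩
      map_add' := fun a b => by ext1; simp [add_mul]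
      map_smul' := fun a b => by
        ext1
        simp only [Submodule.coe_smul, smul_mul_assoc, RingHom.id_apply]
        rfl }
  have hlt : Module.finrank k (quotPiece K t (n + N) N) < Module.finrank k (biforms k t n 0) := by
    rw [finrank_biforms, hN _ _ (by omega) (by omega)]; omega
  obtain ⟨H, hH, hH0⟩ := Submodule.exists_mem_ne_zero_of_ne_bot
    (LinearMap.ker_ne_bot_of_finrank_lt (f := φ) hlt)
  refine ⟨H, H.2, ?_, fun e => hH0 (Subtype.ext e)⟩
  have hmem : (H : CoordRing k) * (u ^ N * v ^ N) ∈ K :=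
    Ideal.Quotient.eq_zero_iff_mem.1 (congrArg Subtype.val hH)
  rw [mul_comm] at hmem
  refine X.mem_sectionIdeal_of_mul_mem (fun P hP => ?_) hmem
  exact mem_nonvanishing_of_mem_biforms hm (by simp [huX P hP, hvX P hP])

/-- If `w(P) = 0`, then `r` divides `w`, and `w` itself lies in the section ideal: at `P` because `r
∈ J_P` by multiplicity one, at the other points of the line `c = 0` because `r` is a unit there. Its
degree `q` is too small for that. -/
lemma HasPointsOnLine.evalAt_ne_zero [IsAlgClosed k] {t : Bool} {P : Point k}
    (hP : P ∈ X.points) (hmult : X.mult P = 1) {r c : CoordRing k}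
    (hr : r ∈ biforms k t 1 0) (hr0 : r ≠ 0) (hrP : evalAt P r = 0)
    (hc : c ∈ biforms k t 0 1) (hc0 : c ≠ 0) (hcP : evalAt P c = 0) {q : ℕ}
    (hq : X.HasPointsOnLine c (q + 1)) {w : CoordRing k} (hw : w ∈ biforms k t q 0)
    (hw0 : w ≠ 0) (hrw : r * w ∈ X.sectionIdeal c) : evalAt P w ≠ 0 := by
  intro hwP
  refine hw0 (HasPointsOnLine.eq_zero_of_mem_sectionIdeal X hq hc hc0 hcP hw ?_)
  have hr' := hr
  have hw' := hw
  rw [← biforms_not] at hr' hw'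
  obtain ⟨w', e⟩ := line_dvd hr' hr0 hrP hw' hwP
  refine mem_saturation_of_local fun P' => ?_
  by_cases hPP' : P' = P
  · subst hPP'
    obtain ⟨s, hs, hsr⟩ := X.mem_component_of_evalAt_eq_zero hP hmult hr hrP
    refine ⟨s, hs, Ideal.mem_sup_left ?_⟩
    rw [e, ← mul_assoc]
    exact X.ideal.mul_mem_right _ hsr
  · by_cases hcP' : evalAt P' c = 0
    · have hrP' : evalAt P' r ≠ 0 := fun hrP' =>
        hPP' (eq_of_lines hr hr0 hrP hrP' hc hc0 hcP hcP').symm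
      obtain ⟨s, hs, hsr⟩ := exists_mem_nonvanishing_of_mem_saturation hrw P'
      exact ⟨s * r, mul_mem hs (mem_nonvanishing_of_mem_biforms hr hrP'), by rwa [mul_assoc]⟩
    · exact ⟨c, mem_nonvanishing_of_mem_biforms hc hcP',
        Ideal.mem_sup_right (Ideal.mul_mem_right _ _ (Ideal.mem_span_singleton_self c))⟩

/-- A separator in the case where the points on a line exhaust one side of the size of `X`. -/
lemma exists_separator_of_mem_ideal [IsAlgClosed k] {t : Bool} {P : Point k}
    (hP : P ∈ X.points) (hmult : X.mult P = 1) {r c : CoordRing k}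
    (hr : r ∈ biforms k t 1 0) (hr0 : r ≠ 0) (hrP : evalAt P r = 0)
    (hc : c ∈ biforms k t 0 1) (hc0 : c ≠ 0) (hcP : evalAt P c = 0) {p q : ℕ}
    (hp : X.HasPointsOnLine r (p + 1)) (hq : X.HasPointsOnLine c (q + 1))
    {u v : CoordRing k} (hu : u ∈ biforms k t 1 0)
    (hv : v ∈ biforms k t 0 1) (huX : ∀ P ∈ X.points, evalAt P u ≠ 0)
    (hvX : ∀ P ∈ X.points, evalAt P v ≠ 0)
    {G : CoordRing k} (hG : G ∈ biforms k t 0 (p + 1)) (hG0 : G ≠ 0) (hGI : G ∈ X.ideal) :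
    ∃ f ∈ biforms k t q p, X.IsSeparator P f := by
  obtain ⟨g, hg, rfl⟩ := exists_eq_line_mul hc hc0 hcP hG (hP _ hGI)
  have hgP : evalAt P g ≠ 0 := by
    refine HasPointsOnLine.evalAt_ne_zero X (t := !t) hP hmult (r := c) (c := r) ?_ hc0 hcP ?_ hr0
      hrP hp ?_ (right_ne_zero_of_mul hG0) (X.ideal_le_sectionIdeal r hGI) <;>
    rwa [biforms_not]
  obtain ⟨H, hH, hHK, hH0⟩ := HasPointsOnLine.exists_mem_sectionIdeal X hq hu hv huX hvX
  have hr' := hr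
  rw [← biforms_not] at hr' hH
  obtain ⟨h, hh, rfl⟩ := exists_eq_line_mul hr' hr0 hrP hH
    (X.evalAt_eq_zero_of_mem_sectionIdeal hP hcP hHK)
  rw [biforms_not] at hh
  have hhP := HasPointsOnLine.evalAt_ne_zero X hP hmult hr hr0 hrP hc hc0 hcP hq hh
    (right_ne_zero_of_mul hH0) hHK
  refine ⟨h * g, mul_mem_biforms' hh hg (by simp) (by simp), by simp [hhP, hgP], ?_⟩
  intro P' hP' hPP'
  by_cases hcP' : evalAt P' c = 0
  · have hrP' : evalAt P' r ≠ 0 := fun hrP' =>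
      hPP' (eq_of_lines hr hr0 hrP hrP' hc hc0 hcP hcP').symm
    obtain ⟨s, hs, hsr⟩ := exists_mem_nonvanishing_of_mem_saturation hHK P'
    refine ⟨s * r, mul_mem hs (mem_nonvanishing_of_mem_biforms hr hrP'), ?_⟩
    obtain ⟨i, hi, e, he, hie⟩ := Submodule.mem_sup.1 hsr
    obtain ⟨e, rfl⟩ := Ideal.mem_span_singleton.1 he
    have : s * r * (h * g) = g * i + e * (c * g) := by linear_combination (-g) * hie
    rw [this]
    exact X.ideal.add_mem (X.ideal.mul_mem_left _ hi) (X.ideal.mul_mem_left _ hGI)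
  · refine ⟨c, mem_nonvanishing_of_mem_biforms hc hcP', ?_⟩
    have : c * (h * g) = h * (c * g) := by ring
    rw [this]
    exact X.ideal.mul_mem_left _ hGI

end
end ZeroDimScheme

/-! ### Powers of the irrelevant ideal, and homogeneous membership in `I + (l)`. -/

section Irrelevant
variable {k : Type*} [Field k]

lemma linear_mem_span_X {t : Bool} {l : CoordRing k} (hl : l ∈ biforms k t 0 1) :
    ∃ a b : k, l = bif t then C a * X (Sum.inr 0) + C b * X (Sum.inr 1)
      else C a * X (Sum.inl 0) + C b * X (Sum.inl 1) := by
  have hli : ∀ s s' : Fin 2 ⊕ Fin 2, s ≠ s' → LinearIndependent k ![(X s : CoordRing k), X s'] := by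
    intro s s' hs
    rw [LinearIndependent.pair_iff]
    intro a b h
    have h1 := congrArg (MvPolynomial.eval (Pi.single s (1 : k))) h
    have h2 := congrArg (MvPolynomial.eval (Pi.single s' (1 : k))) h
    simp [hs, hs.symm] at h1 h2
    exact ⟨h1, h2⟩
  cases t
  · obtain ⟨g, hg, h, hh, rfl⟩ := biforms_succ_le (t := false) (j := 0) (i := 0)
      (isWeightedHomogeneous_X k bidegree (Sum.inl 0))
      (isWeightedHomogeneous_X k bidegree (Sum.inl 1)) (hli _ _ (by simp)) hl
    obtain ⟨a, rfl⟩ := mem_biforms_zero_zero hg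
    obtain ⟨b, rfl⟩ := mem_biforms_zero_zero hh
    exact ⟨a, b, by simp only [cond_false]; ring⟩
  · obtain ⟨g, hg, h, hh, rfl⟩ := biforms_succ_le (t := true) (j := 0) (i := 0)
      (isWeightedHomogeneous_X k bidegree (Sum.inr 0))
      (isWeightedHomogeneous_X k bidegree (Sum.inr 1)) (hli _ _ (by simp)) hl
    obtain ⟨a, rfl⟩ := mem_biforms_zero_zero hg
    obtain ⟨b, rfl⟩ := mem_biforms_zero_zero hh
    exact ⟨a, b, by simp only [cond_true]; ring⟩

lemma linear_mul_linear_mem_irrelevant {t : Bool} {u v : CoordRing k} (hu : u ∈ biforms k t 1 0)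
    (hv : v ∈ biforms k t 0 1) : u * v ∈ irrelevant k := by
  have key : ∀ a b c d : k, (C a * X (Sum.inl 0) + C b * X (Sum.inl 1)) *
      (C c * X (Sum.inr 0) + C d * X (Sum.inr 1)) ∈ irrelevant k := by
    intro a b c d
    have : (C a * X (Sum.inl 0) + C b * X (Sum.inl 1) : CoordRing k) *
      (C c * X (Sum.inr 0) + C d * X (Sum.inr 1)) =
      C (a * c) * (X (Sum.inl 0) * X (Sum.inr 0)) + C (a * d) * (X (Sum.inl 0) * X (Sum.inr 1)) +
      (C (b * c) * (X (Sum.inl 1) * X (Sum.inr 0)) + C (b * d) * (X (Sum.inl 1) * X (Sum.inr 1))) := by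
      simp only [C_mul]; ring
    rw [this]
    refine Ideal.add_mem _ (Ideal.add_mem _ ?_ ?_) (Ideal.add_mem _ ?_ ?_) <;>
      exact Ideal.mul_mem_left _ _ (mul_coord_mem_irrelevant _ _)
  rw [← biforms_not] at hu
  obtain ⟨a, b, rfl⟩ := linear_mem_span_X hu
  obtain ⟨c, d, rfl⟩ := linear_mem_span_X hv
  cases t
  · rw [mul_comm]; exact key _ _ _ _
  · exact key _ _ _ _

/-- Turns the exponent in the definition of `saturation` into an explicit multiplier, for use in
`exists_separator_of_large`. -/
lemma mul_pow_mem_irrelevant_pow {t : Bool} {v : CoordRing k} (hv : v ∈ biforms k t 0 1) (n : ℕ)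
    {g : CoordRing k} (hg : g ∈ biforms k t n 0) : g * v ^ n ∈ irrelevant k ^ n := by
  induction n generalizing g with
  | zero => simp
  | succ n ih =>
    obtain ⟨P⟩ : Nonempty (Point k) := ⟨pointMk (x := ![1, 0]) (y := ![1, 0])
      (fun h => by simpa using congrFun h 0) (fun h => by simpa using congrFun h 0)⟩
    obtain ⟨l, hl, hl0, hlP⟩ := exists_line_through (!t) P
    obtain ⟨l', hl', hlP'⟩ := exists_linear_evalAt_ne_zero (!t) P
    rw [← biforms_not] at hg
    obtain ⟨a, ha, b, hb, rfl⟩ := biforms_succ_le hl hl' (linearIndependent_of_evalAt hl0 hlP hlP') hg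
    rw [biforms_not] at hl hl' ha hb
    have : (l * a + l' * b) * v ^ (n + 1) = (a * v ^ n) * (l * v) + (b * v ^ n) * (l' * v) := by ring
    rw [this, pow_succ]
    exact Ideal.add_mem _ (Ideal.mul_mem_mul (ih ha) (linear_mul_linear_mem_irrelevant hl hv))
      (Ideal.mul_mem_mul (ih hb) (linear_mul_linear_mem_irrelevant hl' hv))

/-- As `I` is homogeneous, the cofactor of `l` may be replaced by its component of degree `d`. -/
lemma exists_sub_mul_mem_of_mem_sup {I : Ideal (CoordRing k)} (hI : I.IsHomogeneous (forms k))
    {d e : ℕ × ℕ} {l f : CoordRing k} (hl : l ∈ forms k e) (hf : f ∈ forms k (e + d))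
    (h : f ∈ I ⊔ Ideal.span {l}) : ∃ g ∈ forms k d, f - l * g ∈ I := by
  obtain ⟨a, ha, b, hb, rfl⟩ := Submodule.mem_sup.1 h
  obtain ⟨b, rfl⟩ := Ideal.mem_span_singleton.1 hb
  refine ⟨DirectSum.decompose (forms k) b d, SetLike.coe_mem _, ?_⟩
  have h1 := DirectSum.decompose_of_mem_same (forms k) hf
  rw [DirectSum.decompose_add, DirectSum.add_apply, Submodule.coe_add,
    DirectSum.coe_decompose_mul_add_of_left_mem (forms k) hl] at h1
  rw [← h1, add_sub_cancel_right]
  exact hI _ ha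

lemma exists_sub_mul_mem_of_mem_sup_biforms {I : Ideal (CoordRing k)}
    (hI : I.IsHomogeneous (forms k)) {t : Bool} {i j : ℕ} {l f : CoordRing k}
    (hl : l ∈ biforms k t 0 1) (hf : f ∈ biforms k t i (j + 1)) (h : f ∈ I ⊔ Ideal.span {l}) :
    ∃ g ∈ biforms k t i j, f - l * g ∈ I := by
  cases t
  · refine exists_sub_mul_mem_of_mem_sup hI hl ?_ h
    rw [show ((bif false then (0, 1) else (1, 0)) + (bif false then (i, j) else (j, i)) : ℕ × ℕ) =
      (j + 1, i) by simp [add_comm]]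
    exact hf
  · refine exists_sub_mul_mem_of_mem_sup hI hl ?_ h
    rw [show ((bif true then (0, 1) else (1, 0)) + (bif true then (i, j) else (j, i)) : ℕ × ℕ) =
      (i, j + 1) by simp [add_comm]]
    exact hf

end Irrelevant

/-! ### Separators of large degree in one family of variables. -/

namespace ZeroDimScheme
section
variable {k : Type*} [Field k] (X : ZeroDimScheme k)

/-- Bézout on `ℙ¹`: `H` and `u` are coprime, since otherwise `H / u` would be a form of degree `q`
in the section ideal. Hence `H` and `u ^ (n + 1)` generate all forms of degree `q + 1 + n`. -/
lemma HasPointsOnLine.exists_eq_mul_add [IsAlgClosed k] {t : Bool} {P Q : Point k} {c u : CoordRing k}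
    (hc : c ∈ biforms k t 0 1) (hc0 : c ≠ 0) (hcP : evalAt P c = 0)
    (hu : u ∈ biforms k t 1 0) (hu0 : u ≠ 0) (huQ : evalAt Q u = 0)
    (huX : ∀ P ∈ X.points, evalAt P u ≠ 0) {q : ℕ} (hq : X.HasPointsOnLine c (q + 1))
    {H : CoordRing k} (hH : H ∈ biforms k t (q + 1) 0) (hHK : H ∈ X.sectionIdeal c) (hH0 : H ≠ 0)
    (n : ℕ) {f : CoordRing k} (hf : f ∈ biforms k t (q + 1 + n) 0) :
    ∃ a ∈ biforms k t n 0, ∃ b ∈ biforms k t q 0, f = H * a + u ^ (n + 1) * b := by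
  have hu' := hu
  rw [← biforms_not] at hu'
  have hHQ : evalAt Q H ≠ 0 := by
    intro hHQ
    have hH' := hH
    rw [← biforms_not] at hH'
    obtain ⟨w, hw, rfl⟩ := exists_eq_line_mul hu' hu0 huQ hH' hHQ
    rw [biforms_not] at hw
    refine right_ne_zero_of_mul hH0 (HasPointsOnLine.eq_zero_of_mem_sectionIdeal X hq hc hc0 hcP hw
      (X.mem_sectionIdeal_of_mul_mem (fun P hP => ?_) hHK))
    exact mem_nonvanishing_of_mem_biforms hu (huX P hP)
  have base : ∀ f ∈ biforms k t (q + 1) 0, ∃ a : k, ∃ b ∈ biforms k t q 0,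
      f = H * C a + u * b := by
    intro f hf
    have hmem : f - (evalAt Q f / evalAt Q H) • H ∈ biforms k t (q + 1) 0 :=
      Submodule.sub_mem _ hf (Submodule.smul_mem _ _ hH)
    rw [← biforms_not] at hmem
    obtain ⟨b, hb, e⟩ := exists_eq_line_mul hu' hu0 huQ hmem
      (by rw [map_sub, evalAt_smul, div_mul_cancel₀ _ hHQ, sub_self])
    rw [biforms_not] at hb
    refine ⟨evalAt Q f / evalAt Q H, b, hb, ?_⟩
    rw [← e, smul_eq_C_mul]; ring
  induction n generalizing f with
  | zero =>
    obtain ⟨a, b, hb, e⟩ := base f hf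
    exact ⟨C a, by simpa [smul_eq_C_mul] using Submodule.smul_mem _ a (one_mem_biforms t), b, hb,
      by simpa using e⟩
  | succ n ih =>
    obtain ⟨l', hl', hlQ'⟩ := exists_linear_evalAt_ne_zero (!t) Q
    rw [← biforms_not] at hf
    obtain ⟨g, hg, h, hh, rfl⟩ := biforms_succ_le hu' hl' (linearIndependent_of_evalAt hu0 huQ hlQ')
      (j := q + 1 + n) hf
    rw [biforms_not] at hg hh hl'
    obtain ⟨a, ha, b, hb, rfl⟩ := ih hg
    obtain ⟨a', ha', b', hb', rfl⟩ := ih hh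
    obtain ⟨α, b'', hb'', e⟩ := base (u * b + l' * b') (Submodule.add_mem _
      (mul_mem_biforms' hu hb (by omega) (by omega)) (mul_mem_biforms' hl' hb' (by omega) (by omega)))
    refine ⟨u * a + l' * a' + α • u ^ (n + 1), Submodule.add_mem _ (Submodule.add_mem _
      (mul_mem_biforms' hu ha (by omega) (by omega)) (mul_mem_biforms' hl' ha' (by omega) (by omega)))
      (Submodule.smul_mem _ _ (pow_mem_biforms_left hu _)), b'', hb'', ?_⟩
    rw [smul_eq_C_mul]
    linear_combination u ^ (n + 1) * e

/-- There are separators of the expected degree in one family of variables and of any sufficiently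
large degree in the other one. -/
lemma exists_separator_of_large [IsAlgClosed k] {t : Bool} {P Q : Point k} (hP : P ∈ X.points)
    {r c : CoordRing k}
    (hr : r ∈ biforms k t 1 0) (hr0 : r ≠ 0) (hrP : evalAt P r = 0)
    (hc : c ∈ biforms k t 0 1) (hc0 : c ≠ 0) (hcP : evalAt P c = 0) {q : ℕ}
    (hq : X.HasPointsOnLine c (q + 1))
    {u v : CoordRing k} (hu : u ∈ biforms k t 1 0) (hu0 : u ≠ 0) (huQ : evalAt Q u = 0)
    (hv : v ∈ biforms k t 0 1) (huX : ∀ P ∈ X.points, evalAt P u ≠ 0)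
    (hvX : ∀ P ∈ X.points, evalAt P v ≠ 0) {a b : ℕ}
    {F : CoordRing k} (hF : F ∈ biforms k t a 0) (hF0 : F ≠ 0) (hFI : F ∈ X.ideal)
    {G : CoordRing k} (hG : G ∈ biforms k t 0 b) (hG0 : G ≠ 0) (hGI : G ∈ X.ideal) :
    ∃ N : ℕ, ∀ j, N ≤ j → ∃ f ∈ biforms k t q j, X.IsSeparator P f := by
  obtain ⟨H, hH, hHK, hH0⟩ := HasPointsOnLine.exists_mem_sectionIdeal X hq hu hv huX hvX
  have hr' := hr
  rw [← biforms_not] at hF hr'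
  obtain ⟨m', i₀, F', hF', hFP', rfl⟩ := exists_eq_line_pow_mul hr' hr0 hrP _ hF hF0
  obtain ⟨m, j₀, G', hG', hGP', rfl⟩ := exists_eq_line_pow_mul hc hc0 hcP _ hG hG0
  rw [biforms_not] at hF'
  have hm : m ≠ 0 := by
    rintro rfl
    exact hGP' (by simpa using hP _ hGI)
  -- `F' * G'` separates `P`, but in too large a degree; the rest of the proof lowers its degree in
  -- the first family to `q`.
  have hFG : ∀ P' ∈ X.points, P' ≠ P → F' * G' ∈ X.component P' := by
    intro P' hP' hPP'
    by_cases hcP' : evalAt P' c = 0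
    · have hrP' : evalAt P' r ≠ 0 := fun hrP' =>
        hPP' (eq_of_lines hr hr0 hrP hrP' hc hc0 hcP hcP').symm
      refine ⟨r ^ m', pow_mem (mem_nonvanishing_of_mem_biforms hr hrP') _, ?_⟩
      rw [← mul_assoc]
      exact X.ideal.mul_mem_right _ hFI
    · refine ⟨c ^ m, pow_mem (mem_nonvanishing_of_mem_biforms hc hcP') _, ?_⟩
      rw [mul_left_comm]
      exact X.ideal.mul_mem_left _ hGI
  have hli := linearIndependent_of_evalAt hc0 hcP (hvX P hP)
  obtain ⟨n₀, hn₀⟩ := hHK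
  -- The term `n₀` makes `B ^ n` carry `H` into `I + (c)`; the term `i₀` leaves room for `F'` in
  -- degree `q + 1 + n`.
  set n := n₀ + i₀ with hn
  have step : ∀ j, n ≤ j + 1 → ∀ f ∈ biforms k t (q + 1 + n) (j + 1),
      ∃ g ∈ biforms k t (q + 1 + n) j, ∃ b ∈ biforms k t q (j + 1),
        f - c * g - u ^ (n + 1) * b ∈ X.ideal := by
    intro j hj f hf
    obtain ⟨g, hg, h, hh, rfl⟩ := biforms_succ_le_pow hc hv hli j hf
    obtain ⟨a, ha, b, hb, rfl⟩ := HasPointsOnLine.exists_eq_mul_add X hc hc0 hcP hu hu0 huQ huX hq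
      hH ⟨n₀, hn₀⟩ hH0 n hh
    have hmem : v ^ (j + 1) * (H * a) ∈ X.ideal ⊔ Ideal.span {c} := by
      have h1 := hn₀ _ (Ideal.pow_le_pow_right (by omega) (mul_pow_mem_irrelevant_pow hv n ha))
      have h2 : v ^ (j + 1) * (H * a) = v ^ (j + 1 - n) * (a * v ^ n * H) := by
        rw [show v ^ (j + 1) = v ^ (j + 1 - n) * v ^ n by rw [← pow_add, Nat.sub_add_cancel hj]]
        ring
      rw [h2]
      exact Ideal.mul_mem_left _ _ h1
    obtain ⟨g', hg', h'⟩ := exists_sub_mul_mem_of_mem_sup_biforms X.homogeneous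
      (i := q + 1 + n) (j := j) hc (mul_mem_biforms' (pow_mem_biforms_right hv (j + 1)) (mul_mem_biforms' hH ha rfl rfl)
        (by omega) (by omega)) hmem
    refine ⟨g + g', Submodule.add_mem _ hg hg', v ^ (j + 1) * b, mul_mem_biforms'
      (pow_mem_biforms_right hv (j + 1)) hb (by omega) (by omega), ?_⟩
    convert h' using 1
    ring
  -- The remainder is pushed into the multiples of `c ^ m`: these vanish at `P`, and multiplication
  -- by `G'` sends them into `I`, because `c ^ m * G'` is the given form of `I`.
  have iter : ∀ m j, n ≤ j → ∀ f ∈ biforms k t (q + 1 + n) (j + m),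
      ∃ g ∈ biforms k t (q + 1 + n) j, ∃ b ∈ biforms k t q (j + m),
        f - c ^ m * g - u ^ (n + 1) * b ∈ X.ideal := by
    intro m j hj
    induction m with
    | zero => exact fun f hf => ⟨f, hf, 0, Submodule.zero_mem _, by simp⟩
    | succ m ih =>
      intro f hf
      obtain ⟨g, hg, b, hb, h⟩ := step (j + m) (by omega) f hf
      obtain ⟨g', hg', b', hb', h'⟩ := ih g hg
      refine ⟨g', hg', b + c * b', Submodule.add_mem _ hb
        (mul_mem_biforms' hc hb' (by omega) (by omega)), ?_⟩
      convert X.ideal.add_mem h (X.ideal.mul_mem_left c h') using 1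
      ring
  have he : F' * G' * (u ^ (q + 1 + n₀) * v ^ (n + m)) ∈ biforms k t (q + 1 + n) (j₀ + n + m) :=
    mul_mem_biforms' (mul_mem_biforms hF' hG') (mul_mem_biforms (pow_mem_biforms_left hu _)
      (pow_mem_biforms_right hv _)) (by omega) (by omega)
  obtain ⟨g, -, b, hb, h⟩ := iter m (j₀ + n) (by omega) _ he
  have hbP : evalAt P b ≠ 0 := by
    intro hbP
    have := hP _ h
    simp only [map_sub, map_mul, map_pow, hcP, hbP, zero_pow hm, zero_mul, mul_zero, sub_zero] at this
    simp [hFP', hGP', huX P hP, hvX P hP] at this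
  refine ⟨j₀ + (j₀ + n + m), fun j hj => ⟨v ^ (j - (j₀ + (j₀ + n + m))) * (G' * b),
    mul_mem_biforms' (pow_mem_biforms_right hv _) (mul_mem_biforms' hG' hb (zero_add _) rfl)
      (zero_add _) (by omega), ?_, ?_⟩⟩
  · simp [hGP', hbP, hvX P hP]
  · intro P' hP' hPP'
    refine Ideal.mul_mem_left _ _ (X.mem_component_of_mul_mem (s := u ^ (n + 1))
      (pow_mem (mem_nonvanishing_of_mem_biforms hu (huX P' hP')) _) ?_)
    -- The first term lies in `J_{P'}` by `hFG`, the other two in `I`; the local unit `u ^ (n + 1)`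
    -- is then cancelled.
    have e : u ^ (n + 1) * (G' * b) = (G' * (u ^ (q + 1 + n₀) * v ^ (n + m))) * (F' * G')
        - g * (c ^ m * G') - G' * (F' * G' * (u ^ (q + 1 + n₀) * v ^ (n + m)) - c ^ m * g -
          u ^ (n + 1) * b) := by ring
    rw [e]
    exact Ideal.sub_mem _ (Ideal.sub_mem _ (Ideal.mul_mem_left _ _ (hFG P' hP' hPP'))
      (X.ideal_le_component P' (X.ideal.mul_mem_left _ hGI)))
      (X.ideal_le_component P' (X.ideal.mul_mem_left _ h))

end
end ZeroDimScheme

/-! ### Sign of the first difference of a Hilbert function, and its summation. -/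

section Dimension
variable {k : Type*} [Field k]

/-- The forms of degree `d` in an ideal, as a subspace of all forms of degree `d`. -/
noncomputable def idealPiece (J : Ideal (CoordRing k)) (d : ℕ × ℕ) : Submodule k (forms k d) :=
  (J.restrictScalars k).comap (forms k d).subtype

lemma mem_idealPiece {J : Ideal (CoordRing k)} {d : ℕ × ℕ} {f : forms k d} :
    f ∈ idealPiece J d ↔ (f : CoordRing k) ∈ J := Iff.rfl

lemma quotDim_add_finrank_idealPiece (J : Ideal (CoordRing k)) (d : ℕ × ℕ) :
    quotDim J d + Module.finrank k (idealPiece J d) = (d.1 + 1) * (d.2 + 1) := by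
  have h := LinearMap.finrank_range_add_finrank_ker
    ((Ideal.Quotient.mkₐ k J).toLinearMap.domRestrict (forms k d))
  rw [LinearMap.range_domRestrict, finrank_forms d.1 d.2] at h
  have hker : idealPiece J d =
      LinearMap.ker ((Ideal.Quotient.mkₐ k J).toLinearMap.domRestrict (forms k d)) := by
    ext f
    exact Ideal.Quotient.eq_zero_iff_mem.symm
  rw [← h, quotDim, hker]

/-- A form of positive bidegree vanishing at `Q` lies in the ideal of the two lines through `Q`. -/
lemma exists_eq_add_of_evalAt_eq_zero {t : Bool} {Q : Point k} {u v : CoordRing k}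
    (hu : u ∈ biforms k t 1 0) (hu0 : u ≠ 0) (huQ : evalAt Q u = 0)
    (hv : v ∈ biforms k t 0 1) (hv0 : v ≠ 0) (hvQ : evalAt Q v = 0) {i j : ℕ} {f : CoordRing k}
    (hf : f ∈ biforms k t (i + 1) (j + 1)) (hfQ : evalAt Q f = 0) :
    ∃ g ∈ biforms k t i (j + 1), ∃ h ∈ biforms k t (i + 1) j, f = u * g + v * h := by
  obtain ⟨v', hv', hvQ'⟩ := exists_linear_evalAt_ne_zero t Q
  obtain ⟨h, hh, g, hg, rfl⟩ := biforms_succ_le_pow hv hv' (linearIndependent_of_evalAt hv0 hvQ hvQ')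
    j hf
  have hgQ : evalAt Q g = 0 := by
    rw [map_add, map_mul, map_mul, hvQ, zero_mul, zero_add, map_pow] at hfQ
    exact (mul_eq_zero.1 hfQ).resolve_left (pow_ne_zero _ hvQ')
  rw [← biforms_not] at hg hu
  obtain ⟨g', hg', rfl⟩ := exists_eq_line_mul hu hu0 huQ hg hgQ
  rw [biforms_not] at hg'
  exact ⟨v' ^ (j + 1) * g', mul_mem_biforms' (pow_mem_biforms_right hv' _) hg' (by omega) (by omega),
    h, hh, by ring⟩

/-- The first difference of the Hilbert function of `S / J` is nonpositive above the degree of a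
form `Φ ∈ J` if the lines `u` and `v`, which do not meet on `Φ`, are regular modulo `J`. -/
lemma quotDim_add_le {J : Ideal (CoordRing k)} {Q : Point k} {u v : CoordRing k}
    (hu : u ∈ biforms k true 1 0) (hu0 : u ≠ 0) (huQ : evalAt Q u = 0)
    (hv : v ∈ biforms k true 0 1) (hv0 : v ≠ 0) (hvQ : evalAt Q v = 0)
    (huJ : ∀ f, u * f ∈ J → f ∈ J) (hvJ : ∀ f, v * f ∈ J → f ∈ J) {q p : ℕ}
    {Φ : CoordRing k} (hΦ : Φ ∈ biforms k true q p) (hΦJ : Φ ∈ J) (hΦQ : evalAt Q Φ ≠ 0)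
    {i j : ℕ} (hi : q ≤ i + 1) (hj : p ≤ j + 1) :
    quotDim J (i + 1, j + 1) + quotDim J (i, j) ≤ quotDim J (i + 1, j) + quotDim J (i, j + 1) := by
  let W : ℕ → ℕ → Submodule k (CoordRing k ⧸ J) := fun i j =>
    (biforms k true i j).map (Ideal.Quotient.mkₐ k J).toLinearMap
  have hfin : ∀ i j, Module.Finite k (W i j) := fun i j => Module.Finite.map _ _
  have hW : ∀ i j, quotDim J (i, j) = Module.finrank k (W i j) := fun i j => rfl
  let L : CoordRing k → (CoordRing k ⧸ J) →ₗ[k] (CoordRing k ⧸ J) := fun w =>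
    LinearMap.mulLeft k (Ideal.Quotient.mk J w)
  have hL : ∀ w, (∀ f, w * f ∈ J → f ∈ J) → Function.Injective (L w) := by
    intro w hw
    rw [← LinearMap.ker_eq_bot, LinearMap.ker_eq_bot']
    intro z hz
    obtain ⟨z, rfl⟩ := Ideal.Quotient.mk_surjective z
    refine Ideal.Quotient.eq_zero_iff_mem.2 (hw z (Ideal.Quotient.eq_zero_iff_mem.1 ?_))
    rw [map_mul]; exact hz
  have hmap : ∀ w, (∀ f, w * f ∈ J → f ∈ J) → ∀ V : Submodule k (CoordRing k ⧸ J),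
      Module.finrank k (V.map (L w)) = Module.finrank k V := fun w hw V =>
    (Submodule.equivMapOfInjective _ (hL w hw) V).symm.finrank_eq
  -- In positive bidegree, `(u, v)` has codimension one in the forms, the quotient being the value
  -- at `Q`. A multiple of `Φ ∈ J` with nonzero value at `Q` removes this last dimension.
  have hle : W (i + 1) (j + 1) ≤ (W i (j + 1)).map (L u) ⊔ (W (i + 1) j).map (L v) := by
    rintro _ ⟨f, hf, rfl⟩
    obtain ⟨w, hw, hwQ⟩ := exists_evalAt_ne_zero true Q (i + 1 - q) (j + 1 - p)
    have hΨ : Φ * w ∈ biforms k true (i + 1) (j + 1) :=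
      mul_mem_biforms' hΦ hw (by omega) (by omega)
    obtain ⟨g, hg, h, hh, e⟩ := exists_eq_add_of_evalAt_eq_zero hu hu0 huQ hv hv0 hvQ
      (f := f - (evalAt Q f / evalAt Q (Φ * w)) • (Φ * w))
      (Submodule.sub_mem _ hf (Submodule.smul_mem _ _ hΨ)) (by
        rw [map_sub, evalAt_smul, div_mul_cancel₀, sub_self]
        rw [map_mul]; exact mul_ne_zero hΦQ hwQ)
    refine Submodule.mem_sup.2 ⟨Ideal.Quotient.mk J (u * g), ⟨Ideal.Quotient.mk J g, ⟨g, hg, rfl⟩, rfl⟩,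
      Ideal.Quotient.mk J (v * h), ⟨Ideal.Quotient.mk J h, ⟨h, hh, rfl⟩, rfl⟩, ?_⟩
    rw [← map_add, ← e]
    refine Ideal.Quotient.eq.2 ?_
    rw [sub_sub_cancel_left, smul_eq_C_mul]
    exact J.neg_mem (J.mul_mem_left _ (J.mul_mem_right _ hΦJ))
  have hge : ((W i j).map (L v)).map (L u) ≤
      (W i (j + 1)).map (L u) ⊓ (W (i + 1) j).map (L v) := by
    rintro _ ⟨_, ⟨_, ⟨f, hf, rfl⟩, rfl⟩, rfl⟩
    refine ⟨⟨Ideal.Quotient.mk J (v * f), ⟨v * f, mul_mem_biforms' hv hf (by omega) (by omega), rfl⟩,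
      rfl⟩, ⟨Ideal.Quotient.mk J (u * f), ⟨u * f, mul_mem_biforms' hu hf (by omega) (by omega), rfl⟩,
      ?_⟩⟩
    change Ideal.Quotient.mk J v * Ideal.Quotient.mk J (u * f) =
      Ideal.Quotient.mk J u * (Ideal.Quotient.mk J v * Ideal.Quotient.mk J f)
    rw [← map_mul, ← map_mul, ← map_mul, mul_left_comm]
  have h1 := Submodule.finrank_mono hle
  have h2 := Submodule.finrank_mono hge
  have h3 := Submodule.finrank_sup_add_finrank_inf_eq ((W i (j + 1)).map (L u))
    ((W (i + 1) j).map (L v))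
  rw [hmap u huJ, hmap v hvJ] at h2 h3
  rw [hW, hW, hW, hW]
  omega

/-- Summation of a difference inequality over a rectangle. -/
lemma rectangle_le {A : ℕ → ℕ → ℤ} {q p : ℕ}
    (h : ∀ i j, q ≤ i → p ≤ j → A (i + 1) (j + 1) + A i j ≤ A (i + 1) j + A i (j + 1)) (m n : ℕ) :
    A (q + m) (p + n) + A q p ≤ A (q + m) p + A q (p + n) := by
  have row : ∀ i, q ≤ i → ∀ n, A (i + 1) (p + n) + A i p ≤ A (i + 1) p + A i (p + n) := by
    intro i hi n
    induction n with
    | zero => simp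
    | succ n ih => have := h i (p + n) hi (by omega); rw [← add_assoc]; omega
  induction m with
  | zero => simp [add_comm]
  | succ m ih => have := row (q + m) (by omega) n; rw [← add_assoc]; omega

end Dimension

/-! ### Comparison of `X` with its part away from `P`, and the separator in the third case. -/

namespace ZeroDimScheme
section
variable {k : Type*} [Field k] (X : ZeroDimScheme k)

/-- The ideal of the part of `X` away from `P`. -/
noncomputable def residualIdeal (P : Point k) : Ideal (CoordRing k) :=
  ⨅ P' ∈ {P' | P' ∈ X.points ∧ P' ≠ P}, X.component P'

lemma mem_residualIdeal {P : Point k} {f : CoordRing k} :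
    f ∈ X.residualIdeal P ↔ ∀ P' ∈ X.points, P' ≠ P → f ∈ X.component P' := by
  simp [residualIdeal]

lemma ideal_le_residualIdeal (P : Point k) : X.ideal ≤ X.residualIdeal P := fun _ hf =>
  X.mem_residualIdeal.2 fun P' _ _ => X.ideal_le_component P' hf

lemma mem_residualIdeal_of_mul_mem {P : Point k} {u f : CoordRing k}
    (hu : ∀ P ∈ X.points, u ∈ nonvanishing P) (h : u * f ∈ X.residualIdeal P) :
    f ∈ X.residualIdeal P := by
  rw [mem_residualIdeal] at h ⊢
  exact fun P' hP' hPP' => X.mem_component_of_mul_mem (hu P' hP') (h P' hP' hPP')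

lemma mem_ideal_iff_residualIdeal [IsAlgClosed k] {P : Point k} (hP : P ∈ X.points)
    (hmult : X.mult P = 1) {d : ℕ × ℕ} {f : CoordRing k} (hf : f ∈ forms k d) :
    f ∈ X.ideal ↔ f ∈ X.residualIdeal P ∧ evalAt P f = 0 := by
  refine ⟨fun h => ⟨X.ideal_le_residualIdeal P h, hP f h⟩, fun ⟨h, hfP⟩ => ?_⟩
  refine X.mem_ideal_of_forall_component fun P' hP' => ?_
  by_cases hPP' : P' = P
  · subst hPP'
    exact X.mem_component_of_evalAt_eq_zero hP hmult hf hfP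
  · exact X.mem_residualIdeal.1 h P' hP' hPP'

/-- Evaluation at `P` on the forms of degree `d` in the residual ideal has the forms in `I(X)` as
kernel, and a separator makes it surjective onto `k`. -/
lemma quotDim_eq_of_separator [IsAlgClosed k] {P : Point k} (hP : P ∈ X.points)
    (hmult : X.mult P = 1) {d : ℕ × ℕ} {f : CoordRing k} (hf : f ∈ forms k d)
    (hsep : X.IsSeparator P f) :
    quotDim X.ideal d = quotDim (X.residualIdeal P) d + 1 := by
  let φ : idealPiece (X.residualIdeal P) d →ₗ[k] k :=
    (evalLinear P ∘ₗ (forms k d).subtype).domRestrict _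
  have hφ : LinearMap.range φ = ⊤ := by
    refine LinearMap.range_eq_top.2 (LinearMap.surjective ?_)
    intro h0
    exact hsep.1 (LinearMap.congr_fun h0 ⟨⟨f, hf⟩, X.mem_residualIdeal.2 hsep.2⟩)
  have hker : (LinearMap.ker φ).map (idealPiece (X.residualIdeal P) d).subtype =
      idealPiece X.ideal d := by
    ext g
    rw [mem_idealPiece, X.mem_ideal_iff_residualIdeal hP hmult g.2]
    constructor
    · rintro ⟨g, hg, rfl⟩
      exact ⟨g.2, hg⟩
    · rintro ⟨h1, h2⟩
      exact ⟨⟨g, h1⟩, h2, rfl⟩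
  have h1 := LinearMap.finrank_range_add_finrank_ker
    (V := idealPiece (X.residualIdeal P) d) φ
  rw [hφ, finrank_top, Module.finrank_self, ← Submodule.finrank_map_subtype_eq, hker] at h1
  have h2 := quotDim_add_finrank_idealPiece X.ideal d
  have h3 := quotDim_add_finrank_idealPiece (X.residualIdeal P) d
  omega

lemma quotDim_eq_of_no_separator [IsAlgClosed k] {P : Point k} (hP : P ∈ X.points)
    (hmult : X.mult P = 1) {d : ℕ × ℕ} (hsep : ¬ ∃ f ∈ forms k d, X.IsSeparator P f) :
    quotDim X.ideal d = quotDim (X.residualIdeal P) d := by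
  have : idealPiece X.ideal d = idealPiece (X.residualIdeal P) d := by
    ext f
    rw [mem_idealPiece, mem_idealPiece, X.mem_ideal_iff_residualIdeal hP hmult f.2,
      and_iff_left_iff_imp]
    intro h
    by_contra hfP
    exact hsep ⟨f, f.2, hfP, X.mem_residualIdeal.1 h⟩
  have h2 := quotDim_add_finrank_idealPiece X.ideal d
  have h3 := quotDim_add_finrank_idealPiece (X.residualIdeal P) d
  rw [this] at h2
  omega

lemma hilbert_natCast (i j : ℕ) : X.hilbert i j = quotDim X.ideal (i, j) := by
  simp [hilbert]

lemma hilbertDiff_succ (i j : ℕ) : X.hilbertDiff ((i : ℤ) + 1) ((j : ℤ) + 1) =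
    quotDim X.ideal (i + 1, j + 1) - quotDim X.ideal (i, j + 1) - quotDim X.ideal (i + 1, j) +
      quotDim X.ideal (i, j) := by
  rw [hilbertDiff, add_sub_cancel_right, add_sub_cancel_right, ← Nat.cast_succ, ← Nat.cast_succ]
  simp only [hilbert_natCast]

/-- The ideal contains a form in every degree in which the first difference vanishes. -/
lemma exists_mem_ideal_of_hilbertDiff_eq_zero {i j : ℕ}
    (h : X.hilbertDiff ((i : ℤ) + 1) ((j : ℤ) + 1) = 0) :
    ∃ f ∈ X.ideal, f ∈ biforms k true (i + 1) (j + 1) ∧ f ≠ 0 := by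
  by_contra hcon
  push Not at hcon
  -- A form of the ideal in a smaller degree could be multiplied up by powers of `x₀` and `y₀`. So
  -- the Hilbert function is that of `S` at all four corners, and its mixed difference is `1`.
  have hdim : ∀ i' j', i' ≤ i + 1 → j' ≤ j + 1 → quotDim X.ideal (i', j') = (i' + 1) * (j' + 1) := by
    intro i' j' hi hj
    have hbot : idealPiece X.ideal (i', j') = ⊥ := by
      rw [Submodule.eq_bot_iff]
      intro f hf
      by_contra hf0
      have hX : ∀ s : Fin 2 ⊕ Fin 2, (MvPolynomial.X s : CoordRing k) ≠ 0 := fun s => X_ne_zero s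
      have h1 : (MvPolynomial.X (Sum.inl 0) : CoordRing k) ∈ biforms k true 1 0 :=
        isWeightedHomogeneous_X k bidegree _
      have h2 : (MvPolynomial.X (Sum.inr 0) : CoordRing k) ∈ biforms k true 0 1 :=
        isWeightedHomogeneous_X k bidegree _
      have hfm : (f : CoordRing k) ∈ biforms k true i' j' := f.2
      have hne : MvPolynomial.X (Sum.inl 0) ^ (i + 1 - i') * MvPolynomial.X (Sum.inr 0) ^ (j + 1 - j') *
          (f : CoordRing k) ≠ 0 := mul_ne_zero (mul_ne_zero (pow_ne_zero _ (hX _))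
            (pow_ne_zero _ (hX _))) fun e => hf0 (Subtype.ext e)
      exact hne (hcon _ (X.ideal.mul_mem_left _ hf) (mul_mem_biforms' (mul_mem_biforms
        (pow_mem_biforms_left h1 _) (pow_mem_biforms_right h2 _)) hfm (by omega) (by omega)))
    have := quotDim_add_finrank_idealPiece X.ideal (i', j')
    rwa [hbot, finrank_bot, add_zero] at this
  rw [hilbertDiff_succ, hdim _ _ (by omega) (by omega), hdim _ _ (by omega) (by omega),
    hdim _ _ (by omega) (by omega), hdim _ _ (by omega) (by omega)] at h
  push_cast at h
  ring_nf at h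
  omega

/-- A separator in the case of a vanishing first difference. -/
lemma exists_separator_of_hilbertDiff [IsAlgClosed k] {P Q : Point k} (hP : P ∈ X.points)
    (hmult : X.mult P = 1) {p q N : ℕ}
    (hsepx : ∀ j, N ≤ j → ∃ f ∈ forms k (q, j), X.IsSeparator P f)
    (hsepy : ∀ i, N ≤ i → ∃ f ∈ forms k (i, p), X.IsSeparator P f)
    {u v : CoordRing k} (hu : u ∈ biforms k true 1 0) (hu0 : u ≠ 0) (huQ : evalAt Q u = 0)
    (hv : v ∈ biforms k true 0 1) (hv0 : v ≠ 0) (hvQ : evalAt Q v = 0)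
    (huX : ∀ P ∈ X.points, evalAt P u ≠ 0) (hvX : ∀ P ∈ X.points, evalAt P v ≠ 0)
    {Φ : CoordRing k} (hΦ : Φ ∈ biforms k true (q + 1) (p + 1)) (hΦI : Φ ∈ X.ideal)
    (hΦQ : evalAt Q Φ ≠ 0)
    (h : ∀ i j : ℤ, (q : ℤ) + 1 ≤ i → (p : ℤ) + 1 ≤ j → X.hilbertDiff i j = 0) :
    ∃ f ∈ forms k (q, p), X.IsSeparator P f := by
  by_contra hno
  have huX' : ∀ P ∈ X.points, u ∈ nonvanishing P := fun P hP =>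
    mem_nonvanishing_of_mem_biforms hu (huX P hP)
  have hvX' : ∀ P ∈ X.points, v ∈ nonvanishing P := fun P hP =>
    mem_nonvanishing_of_mem_biforms hv (hvX P hP)
  have h1 := rectangle_le (A := fun i j => (quotDim (X.residualIdeal P) (i, j) : ℤ)) (q := q) (p := p)
    (fun i j hi hj => by
      exact_mod_cast quotDim_add_le hu hu0 huQ hv hv0 hvQ
        (fun f hf => X.mem_residualIdeal_of_mul_mem huX' hf)
        (fun f hf => X.mem_residualIdeal_of_mul_mem hvX' hf) hΦ (X.ideal_le_residualIdeal P hΦI) hΦQ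
        (Nat.succ_le_succ hi) (Nat.succ_le_succ hj)) N N
  -- For `X` the difference is zero, so the negated function satisfies the hypothesis too and gives
  -- the inequality opposite to `h1`.
  have h2 := rectangle_le (A := fun i j => -(quotDim X.ideal (i, j) : ℤ)) (q := q) (p := p)
    (fun i j hi hj => by
      have := h (i + 1) (j + 1) (by omega) (by omega)
      rw [hilbertDiff_succ] at this
      omega) N N
  obtain ⟨f, hf, hsf⟩ := hsepx (p + N) (by omega)
  obtain ⟨g, hg, hsg⟩ := hsepy (q + N) (by omega)
  have h3 := X.quotDim_eq_of_separator hP hmult hf hsf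
  have h4 := X.quotDim_eq_of_separator hP hmult hg hsg
  obtain ⟨w, hw, hwP⟩ := exists_evalAt_ne_zero true P N 0
  have hwf : w * f ∈ forms k (q + N, p + N) :=
    mul_mem_biforms' (t := true) (m := q + N) (n := p + N) hw hf (by omega) (by omega)
  have h5 := X.quotDim_eq_of_separator hP hmult hwf
    ⟨by rw [map_mul]; exact mul_ne_zero hwP hsf.1,
      fun P' hP' hPP' => Ideal.mul_mem_left _ _ (hsf.2 P' hP' hPP')⟩
  -- The two Hilbert functions differ by `1` at the three outer corners and agree at `(q, p)`, which
  -- is incompatible with `h1` and `h2`.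
  have h6 := X.quotDim_eq_of_no_separator hP hmult hno
  omega

/-- Lines of both families which avoid `X` and meet outside of a given curve. -/
lemma exists_lines [IsAlgClosed k] {a b q p : ℕ} {F G Φ : CoordRing k}
    (hF : F ∈ biforms k true a 0) (hF0 : F ≠ 0) (hFI : F ∈ X.ideal)
    (hG : G ∈ biforms k true 0 b) (hG0 : G ≠ 0) (hGI : G ∈ X.ideal)
    (hΦ : Φ ∈ biforms k true q p) (hΦ0 : Φ ≠ 0) :
    ∃ Q : Point k, evalAt Q Φ ≠ 0 ∧
      (∃ u ∈ biforms k true 1 0, u ≠ 0 ∧ evalAt Q u = 0 ∧ ∀ P ∈ X.points, evalAt P u ≠ 0) ∧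
      ∃ v ∈ biforms k true 0 1, v ≠ 0 ∧ evalAt Q v = 0 ∧ ∀ P ∈ X.points, evalAt P v ≠ 0 := by
  have : Infinite k := IsAlgClosed.instInfinite
  obtain ⟨Q, hQ⟩ := exists_point_evalAt_ne_zero (mul_mem_biforms (mul_mem_biforms hF hG) hΦ)
    (mul_ne_zero (mul_ne_zero hF0 hG0) hΦ0)
  simp only [map_mul, ne_eq, mul_eq_zero, not_or] at hQ
  have key : ∀ (t : Bool) (n : ℕ) (E : CoordRing k), E ∈ biforms k t 0 n → E ∈ X.ideal →
      evalAt Q E ≠ 0 → ∃ u ∈ biforms k t 0 1, u ≠ 0 ∧ evalAt Q u = 0 ∧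
        ∀ P ∈ X.points, evalAt P u ≠ 0 := by
    intro t n E hE hEI hEQ
    obtain ⟨u, hu, hu0, huQ⟩ := exists_line_through t Q
    -- A line through `Q` meeting `X` would divide `E`, as `E` vanishes on `X`; then `E` would
    -- vanish at `Q`.
    refine ⟨u, hu, hu0, huQ, fun P hP huP => hEQ ?_⟩
    obtain ⟨E', rfl⟩ := line_dvd hu hu0 huP hE (hP E hEI)
    rw [map_mul, huQ, zero_mul]
  exact ⟨Q, hQ.2, key false a F hF hFI hQ.1.1, key true b G hG hGI hQ.1.2⟩

end
end ZeroDimScheme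
end BiProj

/-! ### The three cases of the theorem. -/

theorem mainTheorem3 {k : Type*} [Field k] [IsAlgClosed k]
    (X : BiProj.ZeroDimScheme k) (a b : ℕ) (hab : X.HasSize a b)
    (P : BiProj.Point k) (hP : P ∈ X.points) (hmult : X.mult P = 1)
    (r c : BiProj.CoordRing k)
    (hr : BiProj.IsLineThrough (1, 0) P r) (hc : BiProj.IsLineThrough (0, 1) P c)
    (p q : ℕ) (hp : X.HasPointsOnLine r (p + 1)) (hq : X.HasPointsOnLine c (q + 1))
    (h : p = b ∨ q = a ∨
      (p < b ∧ q < a ∧ ∀ i j : ℤ, (q : ℤ) + 1 ≤ i → (p : ℤ) + 1 ≤ j → X.hilbertDiff i j = 0)) :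
    ∃ f ∈ BiProj.forms k (q, p), X.IsSeparator P f := by
  obtain ⟨⟨⟨F, hFI, hF, hF0⟩, -⟩, ⟨⟨G, hGI, hG, hG0⟩, -⟩⟩ := hab
  obtain ⟨hr, hr0, hrP⟩ := hr
  obtain ⟨hc, hc0, hcP⟩ := hc
  obtain ⟨Φ, i, j, hΦ, hΦ0, hΦ'⟩ : ∃ Φ : BiProj.CoordRing k, ∃ i j, Φ ∈ BiProj.biforms k true i j ∧
      Φ ≠ 0 ∧ ((∀ i j : ℤ, (q : ℤ) + 1 ≤ i → (p : ℤ) + 1 ≤ j → X.hilbertDiff i j = 0) →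
        Φ ∈ X.ideal ∧ i = q + 1 ∧ j = p + 1) := by
    by_cases h0 : ∀ i j : ℤ, (q : ℤ) + 1 ≤ i → (p : ℤ) + 1 ≤ j → X.hilbertDiff i j = 0
    · obtain ⟨Φ, hΦI, hΦ, hΦ0⟩ := X.exists_mem_ideal_of_hilbertDiff_eq_zero (h0 _ _ le_rfl le_rfl)
      exact ⟨Φ, _, _, hΦ, hΦ0, fun _ => ⟨hΦI, rfl, rfl⟩⟩
    -- Without the vanishing of `ΔM_X` only the lines avoiding `X` matter, and the constant `1` puts
    -- no condition on `Q`.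
    · exact ⟨1, 0, 0, BiProj.one_mem_biforms true, one_ne_zero, fun h => absurd h h0⟩
  obtain ⟨Q, hΦQ, ⟨u, hu, hu0, huQ, huX⟩, v, hv, hv0, hvQ, hvX⟩ :=
    X.exists_lines (b := b + 1) hF hF0 hFI hG hG0 hGI hΦ hΦ0
  rcases h with rfl | rfl | ⟨-, -, h⟩
  · exact X.exists_separator_of_mem_ideal (t := true) hP hmult hr hr0 hrP hc hc0 hcP hp hq hu hv
      huX hvX hG hG0 hGI
  · exact X.exists_separator_of_mem_ideal (t := false) hP hmult hc hc0 hcP hr hr0 hrP hq hp hv hu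
      hvX huX hF hF0 hFI
  · obtain ⟨hΦI, rfl, rfl⟩ := hΦ' h
    obtain ⟨N, hN⟩ := X.exists_separator_of_large (t := true) hP hr hr0 hrP hc hc0 hcP hq hu hu0 huQ
      hv huX hvX (b := b + 1) hF hF0 hFI hG hG0 hGI
    obtain ⟨M, hM⟩ := X.exists_separator_of_large (t := false) hP hc hc0 hcP hr hr0 hrP hp hv hv0 hvQ
      hu hvX huX (b := a + 1) hG hG0 hGI hF hF0 hFI
    exact X.exists_separator_of_hilbertDiff (N := max N M) hP hmult
      (fun j hj => hN j ((le_max_left _ _).trans hj)) (fun i hi => hM i ((le_max_right _ _).trans hi))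
      hu hu0 huQ hv hv0 hvQ huX hvX hΦ hΦI hΦQ h
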